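/- Let $d\ge 1$, $s>0$ and $\varepsilon>\max\{d/2,\,1+d/4\}$. For $n\in\mathbb N$, $n\ge1$, let $\mathbb Z_n^d$ be the discrete torus of side length $n$, with the inner product $\langle f,g\rangle=n^{-d}\sum_{z}f(z)\overline{g(z)}$ on $\ell^2(\mathbb Z_n^d)$ and the characters $\psi_w(z)=e^{2\pi i z\cdot w/n}$; let $\lambda_w=-\frac{4}{2d}\sum_{i=1}^d\sin^2(\pi w_i/n)$ be the eigenvalues of the graph Laplacian $\Delta_g$, and put $$(-\Delta_g)^{-2s}f=\sum_{\nu\in\mathbb Z_n^d\setminus\{0\}}(-\lambda_\nu)^{-2s}\langle f,\psi_\nu\rangle\,\psi_\nu ,\qquad a_n=\frac{4\pi^2}{2d\,n^{2}} .$$ Let $\sigma_n=(\sigma_n(z))_{z\in\mathbb Z_n^d}$ be jointly Gaussian with law $\mathcal N(0,a_n^{2s}(-\Delta_g)^{-2s})$ on $\ell^2(\mathbb Z_n^d)$, i.e. centered with $\mathbb E[\langle\sigma_n,f\rangle\langle\sigma_n,g\rangle]=a_n^{2s}\langle(-\Delta_g)^{-2s}f,g\rangle$ for all real $f,g$; equivalently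 $\mathbb E[\sigma_n(x)\sigma_n(y)]=\sum_{\nu\neq0}a_n^{2s}(-\lambda_\nu)^{-2s}\psi_\nu(x-y)$. Start the divisible sandpile from $s_n(x)=1+\sigma_n(x)-n^{-d}\sum_z\sigma_n(z)$: at each time step all vertices with mass larger than $1$ simultaneously keep mass $1$ and distribute their excess uniformly among their $2d$ neighbours. Let $u_n(x)$ be the odometer, the total mass emitted from $x$. It is finite. Let $\mathbb T^d=(\mathbb R/\mathbb Z)^d$ and $$\Xi_n(x)=\sum_{z\in n^{-1}\mathbb Z_n^d}u_n(nz)\,1_{B(z,\frac1{2n})}(x),\qquad x\in\mathbb T^d,$$ with $B(z,\rho)$ the ball in the $\ell^\infty$-metric. Let $H_K^{-\varepsilon}(\mathbb T^d)$ be the Hilbert space completion of the real smooth functions with mean zero on $\mathbb T^d$ under the norm $\|f\|^2=\sum_{\xi\in\mathbb Z^d\setminus\{0\}}\|\xi\|^{-4s}\|\xi\|^{-4\varepsilon}|\widehat f(\xi)|^2$, where functions are considered modulo constants. Then, as $n\to\infty$, $a_n\Xi_n$ converges in law in $H_K^{-\varepsilon}(\mathbb T^d)$ to the Gaussian field $\Xi$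 whose law on $H_K^{-\varepsilon}(\mathbb T^d)$ is the unique one such that for every real $f\in C^\infty(\mathbb T^d)$ with mean zero $$\langle\Xi,f\rangle\sim\mathcal N\bigl(0,\|(-\Delta)^{-(s+1)}f\|_{L^2(\mathbb T^d)}^2\bigr),\qquad (-\Delta)^{a}f:=\sum_{\nu\in\mathbb Z^d\setminus\{0\}}\|\nu\|^{2a}\widehat f(\nu)e^{2\pi i\nu\cdot x}.$$ -/

import Mathlib

open MeasureTheory ProbabilityTheory Filter Topology
open scoped ENNReal ComplexConjugate

namespace Sandpile

noncomputable section

/-! ### The discrete torus -/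

/-- The discrete torus `ℤ_n^d` of side length `n`. -/
abbrev DTorus (d n : ℕ) : Type := Fin d → ZMod n

/-- The scaling `a_n = 4 π² (2d)⁻¹ n⁻²`. -/
def scaling (d n : ℕ) : ℝ := 4 * Real.pi ^ 2 * (2 * (d : ℝ))⁻¹ * ((n : ℝ) ^ 2)⁻¹

/-- The inner product `⟨f, g⟩ = n^{-d} ∑_z f(z) conj (g(z))` of `ℓ²(ℤ_n^d)`. -/
def discInner {d n : ℕ} [NeZero n] (f g : DTorus d n → ℂ) : ℂ :=
  ((n : ℂ) ^ d)⁻¹ * ∑ z, f z * conj (g z)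

/-- The character `ψ_w(z) = exp (2πi z·w/n)`; `ZMod.stdAddChar` sends `j mod n` to
`exp (2πi j/n)`. -/
def discChar {d n : ℕ} [NeZero n] (w z : DTorus d n) : ℂ :=
  ZMod.stdAddChar (∑ i, z i * w i)

/-- The eigenvalue `λ_w = -(4/2d) ∑_i sin² (π w_i / n)` of the graph Laplacian
`Δ_g f(x) = (2d)⁻¹ ∑_{y ∼ x} (f(y) - f(x))` belonging to `ψ_w`. -/
def eigenvalue {d n : ℕ} (w : DTorus d n) : ℝ :=
  -(4 / (2 * (d : ℝ))) * ∑ i, Real.sin (Real.pi * ((w i).val : ℝ) / (n : ℝ)) ^ 2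

/-- The discrete fractional Laplacian
`(-Δ_g)^{-t} f = ∑_{ν ≠ 0} (-λ_ν)^{-t} ⟨f, ψ_ν⟩ ψ_ν`. -/
def discFracLaplacian {d n : ℕ} [NeZero n] (t : ℝ) (f : DTorus d n → ℂ) : DTorus d n → ℂ :=
  fun x => ∑ ν ∈ Finset.univ.filter (fun ν : DTorus d n => ν ≠ 0),
    (((-eigenvalue ν) ^ (-t) : ℝ) : ℂ) * discInner f (discChar ν) * discChar ν x

/-- `σ` has the law `𝒩(0, A)` on `ℓ²(ℤ_n^d)`: it is jointly Gaussian and centered, and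
`𝔼[⟨σ, f⟩ ⟨σ, g⟩] = ⟨A f, g⟩` for all real functions `f`, `g`, where `⟨·,·⟩` is the inner product
of `ℓ²(ℤ_n^d)`. -/
structure IsCenteredGaussian {d n : ℕ} [NeZero n] {Ω : Type*} [MeasurableSpace Ω]
    (P : Measure Ω) (σ : Ω → DTorus d n → ℝ)
    (A : (DTorus d n → ℂ) → DTorus d n → ℂ) : Prop where
  gaussian : HasGaussianLaw σ P
  centered : ∀ x, ∫ ω, σ ω x ∂P = 0
  covariance : ∀ f g : DTorus d n → ℝ,
    ∫ ω, discInner (fun x => (σ ω x : ℂ)) (fun x => (f x : ℂ)) *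
        discInner (fun x => (σ ω x : ℂ)) (fun x => (g x : ℂ)) ∂P
      = discInner (A fun x => (f x : ℂ)) (fun x => (g x : ℂ))

/-! ### The divisible sandpile -/

/-- The initial configuration `s(x) = 1 + σ(x) - n^{-d} ∑_z σ(z)`. -/
def initialConfig {d n : ℕ} [NeZero n] (σ : DTorus d n → ℝ) : DTorus d n → ℝ :=
  fun x => 1 + σ x - ((n : ℝ) ^ d)⁻¹ * ∑ z, σ z

/-- The mass `(η(x) - 1)⁺` emitted from `x` when the unstable vertices of `η` topple. -/
def excess {d n : ℕ} (η : DTorus d n → ℝ) : DTorus d n → ℝ :=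
  fun x => max (η x - 1) 0

/-- One time step: all unstable vertices topple simultaneously, each of them keeping mass `1` and
sending a fraction `1/(2d)` of its excess along each of the `2d` directions `± e_i`. -/
def topple {d n : ℕ} (η : DTorus d n → ℝ) : DTorus d n → ℝ :=
  fun x => η x - excess η x +
    (2 * (d : ℝ))⁻¹ * ∑ i, (excess η (x + Pi.single i 1) + excess η (x - Pi.single i 1))

/-- The mass emitted from `x` in the time step `t`, starting from the configuration `s`. -/
def emission {d n : ℕ} (s : DTorus d n → ℝ) (x : DTorus d n) (t : ℕ) : ℝ :=
  excess (topple^[t] s) x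

/-- The odometer: the total mass emitted from `x` during stabilization. -/
def odometer {d n : ℕ} (s : DTorus d n → ℝ) : DTorus d n → ℝ :=
  fun x => ∑' t, emission s x t

/-! ### The continuum torus -/

/-- The `d`-dimensional torus `𝕋^d = (ℝ/ℤ)^d`; its distance is the `ℓ^∞` distance. -/
abbrev Torus (d : ℕ) : Type := UnitAddTorus (Fin d)

/-- Lebesgue measure on `𝕋^d`, of total mass `1`. -/
def torusMeasure (d : ℕ) : Measure (Torus d) :=
  Measure.pi fun _ => AddCircle.haarAddCircle

instance (d : ℕ) : IsProbabilityMeasure (torusMeasure d) := by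
  unfold torusMeasure; infer_instance

/-- The interpolation `∑_{z ∈ 𝕋_n^d} u(nz) 1_{B(z, 1/(2n))}` of a function `u` on `ℤ_n^d`. -/
def interpolation {d n : ℕ} [NeZero n] (u : DTorus d n → ℝ) : Torus d → ℝ :=
  fun x => ∑ z : DTorus d n, u z *
    (Metric.ball (fun i => ZMod.toAddCircle (z i) : Torus d) (1 / (2 * (n : ℝ)))).indicator
      (fun _ => (1 : ℝ)) x

/-- `f ∈ C^∞(𝕋^d)`, i.e. the corresponding periodic function on `ℝ^d` is smooth. -/
def IsSmooth {d : ℕ} (f : Torus d → ℝ) : Prop :=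
  ContDiff ℝ ((⊤ : ℕ∞) : WithTop ℕ∞)
    (fun x : Fin d → ℝ => f (fun i => (x i : UnitAddCircle)))

/-- The Fourier coefficient `∫ f(z) exp (-2πi ξ·z) dz` of a real function on `𝕋^d`. -/
def fourierCoeff {d : ℕ} (f : Torus d → ℝ) (ξ : Fin d → ℤ) : ℂ :=
  UnitAddTorus.mFourierCoeff (fun x => (f x : ℂ)) ξ

/-- The nonzero frequencies `ℤ^d ∖ {0}`. -/
abbrev Freq (d : ℕ) : Type := {ξ : Fin d → ℤ // ξ ≠ 0}

/-- The frequency `-ξ`. -/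
def Freq.opp {d : ℕ} (ξ : Freq d) : Freq d := ⟨-ξ.1, neg_ne_zero.2 ξ.2⟩

/-- The Euclidean norm of a frequency. -/
def freqNorm {d : ℕ} (ξ : Freq d) : ℝ := Real.sqrt (∑ i, (ξ.1 i : ℝ) ^ 2)

/-- The continuum fractional Laplacian
`(-Δ)^a f(x) = ∑_{ν ≠ 0} ‖ν‖^{2a} f̂(ν) exp (2πi ν·x)`. -/
def fracLaplacian {d : ℕ} (a : ℝ) (f : Torus d → ℝ) (x : Torus d) : ℂ :=
  ∑' ν : Freq d, ((freqNorm ν ^ (2 * a) : ℝ) : ℂ) * fourierCoeff f ν.1 *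
    UnitAddTorus.mFourier ν.1 x

/-! ### The Sobolev space `H^a_K` for the multiplier `K̂(ξ) = ‖ξ‖^{-4s}` -/

/-- The Fourier multiplier `K̂(ξ) = ‖ξ‖^{-4s}`. -/
def multiplier {d : ℕ} (s : ℝ) (ξ : Freq d) : ℝ := freqNorm ξ ^ (-(4 * s))

/-- The weight `K̂(ξ) ‖ξ‖^{4a}`. -/
def weight {d : ℕ} (s a : ℝ) (ξ : Freq d) : ℝ := multiplier s ξ * freqNorm ξ ^ (4 * a)

lemma one_le_freqNorm {d : ℕ} (ξ : Freq d) : 1 ≤ freqNorm ξ := by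
  obtain ⟨i, hi⟩ := Function.ne_iff.1 ξ.2
  refine Real.one_le_sqrt.2 ?_
  have h1 : (1 : ℝ) ≤ (ξ.1 i : ℝ) ^ 2 := by
    have hi' : ξ.1 i ≠ 0 := hi
    have h0 : 0 < (ξ.1 i) ^ 2 := sq_pos_iff.2 hi'
    exact_mod_cast h0
  exact h1.trans (Finset.single_le_sum (f := fun i => (ξ.1 i : ℝ) ^ 2)
    (fun j _ => sq_nonneg _) (Finset.mem_univ i))

lemma weight_pos {d : ℕ} (s a : ℝ) (ξ : Freq d) : 0 < weight s a ξ := by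
  have h := one_le_freqNorm ξ
  have h' : 0 < freqNorm ξ := by linarith
  exact mul_pos (Real.rpow_pos_of_pos h' _) (Real.rpow_pos_of_pos h' _)

lemma weight_opp {d : ℕ} (s a : ℝ) (ξ : Freq d) : weight s a ξ.opp = weight s a ξ := by
  simp [weight, multiplier, freqNorm, Freq.opp]

lemma weight_le_one {d : ℕ} {s a : ℝ} (h : a ≤ s) (ξ : Freq d) : weight s a ξ ≤ 1 := by
  have h1 := one_le_freqNorm ξ
  rw [weight, multiplier, ← Real.rpow_add (by linarith)]
  exact Real.rpow_le_one_of_one_le_of_nonpos h1 (by linarith)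

/-- The square summable families `(v_ξ)` with `v_{-ξ} = conj v_ξ`. -/
def hermitianSubmodule (d : ℕ) : Submodule ℝ (lp (fun _ : Freq d => ℂ) 2) where
  carrier := {v | ∀ ξ : Freq d, v ξ.opp = conj (v ξ)}
  add_mem' := fun hu hv ξ => by simp [hu ξ, hv ξ]
  zero_mem' := fun ξ => by simp
  smul_mem' := fun c v hv ξ => by simp [hv ξ]

/-- The Sobolev space `H^a_K(𝕋^d)` for `K̂(ξ) = ‖ξ‖^{-4s}`, i.e. the Hilbert space completion of
the real mean zero smooth functions under `‖g‖² = ∑_{ξ ≠ 0} K̂(ξ) ‖ξ‖^{4a} |ĝ(ξ)|²`.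
The distribution `g` is stored as the square summable family
`v_ξ = (K̂(ξ) ‖ξ‖^{4a})^{1/2} ĝ(ξ)`. -/
@[nolint unusedArguments]
def SobolevSpace (d : ℕ) (_s _a : ℝ) : Type := hermitianSubmodule d

namespace SobolevSpace

variable {d : ℕ} {s a : ℝ}

instance : NormedAddCommGroup (SobolevSpace d s a) :=
  inferInstanceAs (NormedAddCommGroup (hermitianSubmodule d))

instance : InnerProductSpace ℝ (SobolevSpace d s a) :=
  inferInstanceAs (InnerProductSpace ℝ (hermitianSubmodule d))

instance : MeasurableSpace (SobolevSpace d s a) := borel _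

instance : BorelSpace (SobolevSpace d s a) := ⟨rfl⟩

/-- The Fourier coefficient `ĝ(ξ)` of `g ∈ H^a_K`. -/
def coeff (g : SobolevSpace d s a) (ξ : Freq d) : ℂ :=
  ((Real.sqrt (weight s a ξ))⁻¹ : ℝ) * (g.1 : Freq d → ℂ) ξ

/-- The element of `H^a_K` with given Fourier coefficients. -/
def ofCoeff (c : Freq d → ℂ) (hc : ∀ ξ, c ξ.opp = conj (c ξ))
    (hs : Summable fun ξ => weight s a ξ * ‖c ξ‖ ^ 2) : SobolevSpace d s a :=
  ⟨⟨fun ξ => (Real.sqrt (weight s a ξ) : ℂ) * c ξ, memℓp_gen (by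
    refine hs.congr fun ξ => ?_
    have h := (weight_pos s a ξ).le
    simp only [norm_mul, Complex.norm_real, Real.norm_eq_abs, abs_of_nonneg (Real.sqrt_nonneg _)]
    simp [mul_pow, Real.sq_sqrt h])⟩, fun ξ => by
    simp [weight_opp, hc]⟩

lemma coeff_ofCoeff (c : Freq d → ℂ) (hc : ∀ ξ, c ξ.opp = conj (c ξ))
    (hs : Summable fun ξ => weight s a ξ * ‖c ξ‖ ^ 2) (ξ : Freq d) :
    coeff (ofCoeff (s := s) (a := a) c hc hs) ξ = c ξ := by
  have h := Real.sqrt_ne_zero'.2 (weight_pos s a ξ)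
  change (((Real.sqrt (weight s a ξ))⁻¹ : ℝ) : ℂ) * ((Real.sqrt (weight s a ξ) : ℂ) * c ξ) = c ξ
  rw [← mul_assoc, ← Complex.ofReal_mul, inv_mul_cancel₀ h, Complex.ofReal_one, one_mul]

lemma norm_sq_eq (g : SobolevSpace d s a) :
    ‖g‖ ^ 2 = ∑' ξ, weight s a ξ * ‖coeff g ξ‖ ^ 2 := by
  have h := lp.norm_rpow_eq_tsum (p := 2) (by simp) g.1
  have h' : ‖g‖ ^ 2 = ∑' ξ, ‖(g.1 : Freq d → ℂ) ξ‖ ^ 2 := by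
    change ‖g.1‖ ^ 2 = _
    simpa using h
  rw [h']
  refine tsum_congr fun ξ => ?_
  have hw := weight_pos s a ξ
  rw [coeff, norm_mul, mul_pow, Complex.norm_real, Real.norm_eq_abs, sq_abs, inv_pow,
    Real.sq_sqrt hw.le, ← mul_assoc, mul_inv_cancel₀ hw.ne', one_mul]

instance : CompleteSpace (SobolevSpace d s a) := by
  have hcl : IsClosed (hermitianSubmodule d : Set (lp (fun _ : Freq d => ℂ) 2)) := by
    have : (hermitianSubmodule d : Set (lp (fun _ : Freq d => ℂ) 2)) =
        ⋂ ξ : Freq d, {v | v ξ.opp = conj (v ξ)} := by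
      ext v; simp [hermitianSubmodule]
    rw [this]
    have hev : ∀ ξ : Freq d, Continuous fun v : lp (fun _ : Freq d => ℂ) 2 => v ξ := fun ξ =>
      (lp.evalCLM ℝ (fun _ : Freq d => ℂ) 2 ξ).continuous
    exact isClosed_iInter fun ξ =>
      isClosed_eq (hev _) (Complex.continuous_conj.comp (hev _))
  exact hcl.completeSpace_coe

open Classical in
/-- The element of `H^a_K` given by a function `f` on `𝕋^d` modulo constants: its coefficients are
the `f̂(ξ)`, `ξ ≠ 0` (and `0` if these do not belong to `H^a_K`, which cannot happen for
square integrable `f` and `a ≤ s`). -/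
def ofFun (f : Torus d → ℝ) : SobolevSpace d s a :=
  if h : (∀ ξ : Freq d, fourierCoeff f ξ.opp.1 = conj (fourierCoeff f ξ.1)) ∧
      Summable fun ξ : Freq d => weight s a ξ * ‖fourierCoeff f ξ.1‖ ^ 2
  then ofCoeff (fun ξ => fourierCoeff f ξ.1) h.1 h.2 else 0

/-- The pairing `⟨g, f⟩ = ∑_ξ ĝ(ξ) conj (f̂(ξ))` of `g ∈ H^a_K` with a real mean zero test
function `f` (the sum is real by symmetry). -/
def pairing (f : Torus d → ℝ) (g : SobolevSpace d s a) : ℝ :=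
  ∑' ξ : Freq d, (coeff g ξ * conj (fourierCoeff f ξ.1)).re

end SobolevSpace

lemma fourierCoeff_neg {d : ℕ} (f : Torus d → ℝ) (ξ : Fin d → ℤ) :
    fourierCoeff f (-ξ) = conj (fourierCoeff f ξ) := by
  unfold fourierCoeff UnitAddTorus.mFourierCoeff
  rw [← integral_conj]
  simp [UnitAddTorus.mFourier_neg]

lemma summable_fourierCoeff {d : ℕ} {f : Torus d → ℝ} (hf : MemLp f 2 (torusMeasure d)) :
    Summable fun ξ : Fin d → ℤ => ‖fourierCoeff f ξ‖ ^ 2 := by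
  have hf' : MemLp (fun x => (f x : ℂ)) 2 (torusMeasure d) := hf.ofReal
  have h := (UnitAddTorus.hasSum_sq_mFourierCoeff (d := Fin d) (hf'.toLp _)).summable
  refine h.congr fun ξ => ?_
  have : UnitAddTorus.mFourierCoeff (hf'.toLp _) ξ = fourierCoeff f ξ := by
    unfold fourierCoeff UnitAddTorus.mFourierCoeff
    refine integral_congr_ae ?_
    have := hf'.coeFn_toLp
    filter_upwards [this] with x hx
    rw [hx]
  exact congrArg (fun w : ℂ => ‖w‖ ^ 2) this

lemma memLp_interpolation {d n : ℕ} [NeZero n] (u : DTorus d n → ℝ) (b : ℝ) :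
    MemLp (fun x => b * interpolation u x) 2 (torusMeasure d) := by
  refine MemLp.const_mul ?_ b
  unfold interpolation
  refine memLp_finsetSum _ fun z _ => MemLp.const_mul ?_ _
  exact (memLp_const (1 : ℝ)).indicator Metric.isOpen_ball.measurableSet

lemma SobolevSpace.coeff_ofFun {d : ℕ} {s a : ℝ} (h : a ≤ s) {f : Torus d → ℝ}
    (hf : MemLp f 2 (torusMeasure d)) (ξ : Freq d) :
    (SobolevSpace.ofFun f : SobolevSpace d s a).coeff ξ = fourierCoeff f ξ.1 := by
  have h1 : ∀ ξ : Freq d, fourierCoeff f ξ.opp.1 = conj (fourierCoeff f ξ.1) :=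
    fun ξ => fourierCoeff_neg f ξ.1
  have h2 : Summable fun ξ : Freq d => weight s a ξ * ‖fourierCoeff f ξ.1‖ ^ 2 := by
    refine Summable.of_nonneg_of_le (fun ξ => mul_nonneg (weight_pos s a ξ).le (sq_nonneg _))
      (fun ξ => ?_) ((summable_fourierCoeff hf).comp_injective Subtype.val_injective)
    exact mul_le_of_le_one_left (sq_nonneg _) (weight_le_one h ξ)
  rw [SobolevSpace.ofFun, dif_pos ⟨h1, h2⟩, SobolevSpace.coeff_ofCoeff]

/-- `μ` is a law on `H^a_K` under which `⟨Ξ, f⟩ ∼ 𝒩(0, ‖(-Δ)^{-(s+1)} f‖²_{L²(𝕋^d)})` for every real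
mean zero `f ∈ C^∞(𝕋^d)`. -/
def IsFractionalField {d : ℕ} {s a : ℝ} (μ : Measure (SobolevSpace d s a)) : Prop :=
  ∀ f : Torus d → ℝ, IsSmooth f → ∫ x, f x ∂(torusMeasure d) = 0 →
    μ.map (SobolevSpace.pairing f) =
      gaussianReal 0 (∫ x, ‖fracLaplacian (-(s + 1)) f x‖ ^ 2 ∂(torusMeasure d)).toNNReal

end

end Sandpile

/-!
The odometer `u` of `s` is the least nonnegative function with `u - M u ≥ s - 1`, `M` being the mean
over the neighbours. As `s - 1` has mean zero, the Poisson equation shows that `u` is finite and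
that equality holds, so that `u = (-Δ_g)⁻¹ σ` up to constants. Hence the Fourier coefficient of
`a_n Ξ_n` at `ξ` is that of `σ_n` times `a_n / (-λ_ξ)` and a product of `sinc` factors coming
from the interpolation, so `a_n Ξ_n` is a linear image of `σ_n` and a centered Gaussian field.

In the real orthonormal basis of functions `cos (2πξ·x) - sin (2πξ·x)`, its covariance matrix
converges entrywise to a diagonal one, because `a_n / (-λ_ξ)` tends to `‖ξ‖⁻²`. For `ξ ∉ nℤ^d`,
the bounds `‖ξ‖⁻² ≤ a_n / (-λ_ξ) ≤ π² / 4` control either sign of the power of this ratio in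
the variances, which are therefore bounded by a summable sequence independent of `n`.
For Gaussian laws on a Hilbert space this suffices for weak convergence: finitely many coordinates
are controlled by characteristic functions, and the remaining ones are uniformly small in mean.
-/

namespace Sandpile

noncomputable section

section WhiteNoise

variable {ι : Type*}

lemma lintegral_enorm_sq {Ω : Type*} [MeasurableSpace Ω] {P : Measure Ω} {Y : Ω → ℝ}
    (hY : MemLp Y 2 P) : ∫⁻ ω, ‖Y ω‖ₑ ^ 2 ∂P = ENNReal.ofReal (∫ ω, Y ω ^ 2 ∂P) := by
  rw [ofReal_integral_eq_lintegral_ofReal hY.integrable_sq (.of_forall fun ω => sq_nonneg _)]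
  refine lintegral_congr fun ω => ?_
  rw [Real.enorm_eq_ofReal_abs, ← ENNReal.ofReal_pow (abs_nonneg _), sq_abs]

lemma integral_sq_gaussianReal (v : NNReal) : ∫ x, x ^ 2 ∂gaussianReal 0 v = v := by
  rw [← variance_id_gaussianReal (μ := 0) (v := v),
    variance_of_integral_eq_zero aemeasurable_id integral_id_gaussianReal]
  rfl

variable (ι) in
/-- White noise indexed by `ι`: the law of a family of independent standard Gaussian variables. -/
def whiteNoise : Measure (ι → ℝ) := Measure.infinitePi fun _ => gaussianReal 0 1

instance : IsProbabilityMeasure (whiteNoise ι) := by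
  unfold whiteNoise; infer_instance

lemma measurePreserving_eval_whiteNoise (i : ι) :
    MeasurePreserving (Function.eval i) (whiteNoise ι) (gaussianReal 0 1) :=
  measurePreserving_eval_infinitePi (fun _ => gaussianReal 0 1) i

lemma memLp_eval_whiteNoise (i : ι) : MemLp (fun ω : ι → ℝ => ω i) 2 (whiteNoise ι) :=
  (memLp_id_gaussianReal 2).comp_measurePreserving (measurePreserving_eval_whiteNoise i)

lemma integral_eval_whiteNoise (i : ι) : ∫ ω, ω i ∂whiteNoise ι = 0 := by
  have h := integral_map (measurePreserving_eval_whiteNoise i).aemeasurable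
    (f := fun x : ℝ => x) (by fun_prop)
  rw [(measurePreserving_eval_whiteNoise i).map_eq, integral_id_gaussianReal] at h
  exact h.symm

lemma integral_eval_mul_eval_whiteNoise [DecidableEq ι] (i j : ι) :
    ∫ ω, ω i * ω j ∂whiteNoise ι = if i = j then 1 else 0 := by
  split_ifs with hij
  · subst hij
    have h := integral_map (measurePreserving_eval_whiteNoise i).aemeasurable
      (f := fun x : ℝ => x ^ 2) (by fun_prop)
    rw [(measurePreserving_eval_whiteNoise i).map_eq, integral_sq_gaussianReal] at h
    simpa only [← pow_two, NNReal.coe_one, Function.eval] using h.symm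
  · have hindep : iIndepFun (fun i (ω : ι → ℝ) => ω i) (whiteNoise ι) :=
      iIndepFun_infinitePi (P := fun _ : ι => gaussianReal 0 1) (X := fun _ x => x)
        fun _ => by fun_prop
    rw [(hindep.indepFun hij).integral_fun_mul_eq_mul_integral
      (memLp_eval_whiteNoise i).aestronglyMeasurable
      (memLp_eval_whiteNoise j).aestronglyMeasurable, integral_eval_whiteNoise, zero_mul]

lemma map_mul_whiteNoise (a : ℝ) (i : ι) :
    (whiteNoise ι).map (fun ω => a * ω i) = gaussianReal 0 (a ^ 2).toNNReal := by
  have hcomp : (fun ω : ι → ℝ => a * ω i) = (fun x => a * x) ∘ Function.eval i := rfl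
  rw [hcomp, ← Measure.map_map (by fun_prop) (by fun_prop),
    (measurePreserving_eval_whiteNoise i).map_eq, gaussianReal_map_const_mul, mul_zero, mul_one]
  rw [Real.toNNReal_of_nonneg (sq_nonneg a)]

lemma map_sum_mul_whiteNoise (a : ι → ℝ) (S : Finset ι) :
    (whiteNoise ι).map (fun ω => ∑ i ∈ S, a i * ω i) =
      gaussianReal 0 (∑ i ∈ S, a i ^ 2).toNNReal := by
  classical
  have hindep : iIndepFun (fun i (ω : ι → ℝ) => a i * ω i) (whiteNoise ι) :=
    iIndepFun_infinitePi (P := fun _ : ι => gaussianReal 0 1) (X := fun i x => a i * x)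
      fun i => by fun_prop
  induction S using Finset.induction_on with
  | empty => simp
  | insert j S hj ih =>
    have hi : IndepFun (fun ω => a j * ω j) (fun ω => ∑ i ∈ S, a i * ω i) (whiteNoise ι) := by
      simpa only [Finset.sum_fn] using
        (hindep.indepFun_finsetSum_of_notMem (fun i => by fun_prop) hj).symm
    simp only [Finset.sum_insert hj]
    rw [Real.toNNReal_add (sq_nonneg _) (Finset.sum_nonneg fun i _ => sq_nonneg _),
      ← add_zero (0 : ℝ)]
    exact gaussianReal_add_gaussianReal_of_indepFun hi (map_mul_whiteNoise _ _) ih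

variable [Countable ι]

lemma map_hasSum_mul_whiteNoise {a : ι → ℝ} (ha : Summable fun i => a i ^ 2)
    {Y : (ι → ℝ) → ℝ} (hY : AEMeasurable Y (whiteNoise ι))
    (h : ∀ᵐ ω ∂whiteNoise ι, HasSum (fun i => a i * ω i) (Y ω)) :
    (whiteNoise ι).map Y = gaussianReal 0 (∑' i, a i ^ 2).toNNReal := by
  have : IsProbabilityMeasure ((whiteNoise ι).map Y) := Measure.isProbabilityMeasure_map hY
  have hsum (S : Finset ι) : AEMeasurable (fun ω => ∑ i ∈ S, a i * ω i) (whiteNoise ι) :=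
    Measurable.aemeasurable (by fun_prop)
  refine Measure.ext_of_charFun (funext fun r => tendsto_nhds_unique (f := fun S : Finset ι =>
    charFun ((whiteNoise ι).map fun ω => ∑ i ∈ S, a i * ω i) r) (l := atTop) ?_ ?_)
  · simp only [charFun_eq_integral_innerProbChar]
    exact (ProbabilityMeasure.tendsto_iff_forall_integral_rclike_tendsto ℂ).1
      (tendstoInDistribution_of_ae_tendsto hsum hY h).tendsto _
  · simp only [map_sum_mul_whiteNoise, charFun_gaussianReal]
    have hcont : Continuous fun v : ℝ => Complex.exp (r * (0 : ℝ) * Complex.I -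
      (v.toNNReal : ℝ) * r ^ 2 / 2) := by fun_prop
    exact (hcont.tendsto _).comp ha.hasSum

lemma ae_summable_sq_whiteNoise {a : ι → ℝ} (ha : Summable fun i => a i ^ 2) :
    ∀ᵐ ω ∂whiteNoise ι, Summable fun i => (a i * ω i) ^ 2 := by
  have hsq (i : ι) : ∫⁻ ω, ‖a i * ω i‖ₑ ^ 2 ∂whiteNoise ι = ENNReal.ofReal (a i ^ 2) := by
    rw [lintegral_enorm_sq ((memLp_eval_whiteNoise i).const_mul (a i))]
    classical
    have h := integral_eval_mul_eval_whiteNoise i i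
    simp only [if_true, ← pow_two] at h
    simp only [mul_pow, integral_const_mul, h, mul_one]
  have hmeas (i : ι) : Measurable fun ω : ι → ℝ => ‖a i * ω i‖ₑ ^ 2 :=
    Measurable.pow_const (Measurable.enorm (by fun_prop)) 2
  have hfin : ∫⁻ ω, ∑' i, ‖a i * ω i‖ₑ ^ 2 ∂whiteNoise ι ≠ ∞ := by
    rw [lintegral_tsum fun i => (hmeas i).aemeasurable]
    simp only [hsq]
    exact ha.tsum_ofReal_ne_top
  filter_upwards [ae_lt_top (Measurable.tsum hmeas) hfin] with ω hω
  refine (ENNReal.summable_toReal hω.ne).congr fun i => ?_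
  rw [ENNReal.toReal_pow, toReal_enorm, Real.norm_eq_abs, sq_abs]

end WhiteNoise

section OrthonormalSeries

variable {𝕜 ι E : Type*} [RCLike 𝕜] [NormedAddCommGroup E] [InnerProductSpace 𝕜 E] {b : ι → E}
  (hb : Orthonormal 𝕜 b)

include hb

lemma summable_smul_of_orthonormal [CompleteSpace E] {c : ι → 𝕜}
    (hc : Summable fun i => ‖c i‖ ^ 2) : Summable fun i => c i • b i :=
  (hb.orthogonalFamily.summable_iff_norm_sq_summable c).2 hc

variable {c : ι → 𝕜} {x : E} (hx : HasSum (fun i => c i • b i) x)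

include hx

lemma inner_eq_of_hasSum_orthonormal (i : ι) : inner 𝕜 (b i) x = c i := by
  have h := (hx.mapL (innerSL 𝕜 (b i))).unique (hasSum_single i fun k hk => by
    rw [innerSL_apply_apply, inner_smul_right, hb.2 hk.symm, mul_zero])
  rw [innerSL_apply_apply, innerSL_apply_apply, inner_smul_right, inner_self_eq_norm_sq_to_K,
    hb.norm_eq_one] at h
  simpa using h

lemma norm_sq_eq_tsum_of_hasSum_orthonormal : ‖x‖ ^ 2 = ∑' i, ‖c i‖ ^ 2 := by
  have hre : HasSum (fun i => ‖c i‖ ^ 2) (RCLike.re (inner 𝕜 x x)) := by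
    refine (RCLike.hasSum_re 𝕜 (hx.mapL (innerSL 𝕜 x))).congr_fun fun i => ?_
    rw [innerSL_apply_apply, inner_smul_right, ← inner_conj_symm,
      inner_eq_of_hasSum_orthonormal hb hx, RCLike.mul_conj]
    norm_cast
  rw [hre.tsum_eq, inner_self_eq_norm_sq]

end OrthonormalSeries

section GaussianSeries

variable {ι H : Type*} [NormedAddCommGroup H] [InnerProductSpace ℝ H]
  [CompleteSpace H]

variable [Countable ι]

lemma ae_hasSum_gaussianSeries {b : ι → H} (hb : Orthonormal ℝ b) {c : ι → ℝ}
    (hc : Summable fun i => c i ^ 2) :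
    ∀ᵐ ω ∂whiteNoise ι, HasSum (fun i => (c i * ω i) • b i) (∑' i, (c i * ω i) • b i) := by
  filter_upwards [ae_summable_sq_whiteNoise hc] with ω hω
  refine (summable_smul_of_orthonormal hb ?_).hasSum
  simpa only [Real.norm_eq_abs, sq_abs] using hω

variable [MeasurableSpace H] [BorelSpace H]

/-- The law of the Gaussian series `∑ i, c i * g i • b i` with independent standard Gaussian
coefficients `g i`. -/
def gaussianSeriesLaw (b : ι → H) (c : ι → ℝ) : Measure H :=
  (whiteNoise ι).map fun ω => ∑' i, (c i * ω i) • b i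

variable [SecondCountableTopology H] {b : ι → H} (hb : Orthonormal ℝ b) {c : ι → ℝ}
  (hc : Summable fun i => c i ^ 2)

include hb hc

lemma aemeasurable_gaussianSeries :
    AEMeasurable (fun ω : ι → ℝ => ∑' i, (c i * ω i) • b i) (whiteNoise ι) :=
  aemeasurable_of_tendsto_metrizable_ae (atTop : Filter (Finset ι))
    (fun S => Measurable.aemeasurable (by fun_prop)) (ae_hasSum_gaussianSeries hb hc)

lemma isProbabilityMeasure_gaussianSeriesLaw : IsProbabilityMeasure (gaussianSeriesLaw b c) :=
  Measure.isProbabilityMeasure_map (aemeasurable_gaussianSeries hb hc)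

lemma map_inner_gaussianSeriesLaw (t : H) :
    (gaussianSeriesLaw b c).map (fun x => inner ℝ t x) =
      gaussianReal 0 (∑' i, (c i * inner ℝ t (b i)) ^ 2).toNNReal := by
  have hX := aemeasurable_gaussianSeries hb hc
  have hvar : Summable fun i => (c i * inner ℝ t (b i)) ^ 2 := by
    refine .of_nonneg_of_le (fun i => sq_nonneg _) (fun i => ?_) (hc.mul_right (‖t‖ ^ 2))
    rw [mul_pow]
    gcongr _ * ?_
    have h := norm_inner_le_norm (𝕜 := ℝ) t (b i)
    rw [hb.norm_eq_one, mul_one] at h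
    exact sq_le_sq' (neg_le_of_abs_le h) (le_of_abs_le h)
  rw [gaussianSeriesLaw, AEMeasurable.map_map_of_aemeasurable (by fun_prop) hX]
  refine map_hasSum_mul_whiteNoise hvar (by fun_prop) ?_
  filter_upwards [ae_hasSum_gaussianSeries hb hc] with ω hω
  simpa only [innerSL_apply_apply, inner_smul_right, mul_right_comm, Function.comp_apply]
    using hω.mapL (innerSL ℝ t)

lemma integral_inner_mul_inner_gaussianSeriesLaw [DecidableEq ι] (i j : ι) :
    ∫ x, inner ℝ (b i) x * inner ℝ (b j) x ∂gaussianSeriesLaw b c =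
      if i = j then c i ^ 2 else 0 := by
  have hX := aemeasurable_gaussianSeries hb hc
  rw [gaussianSeriesLaw, integral_map hX (by fun_prop)]
  have hcoord : ∀ᵐ ω ∂whiteNoise ι, ∀ i, inner ℝ (b i) (∑' k, (c k * ω k) • b k) = c i * ω i := by
    filter_upwards [ae_hasSum_gaussianSeries hb hc] with ω hω i
    exact inner_eq_of_hasSum_orthonormal hb hω i
  have hprod : ∀ᵐ ω ∂whiteNoise ι, inner ℝ (b i) (∑' k, (c k * ω k) • b k) *
      inner ℝ (b j) (∑' k, (c k * ω k) • b k) = c i * c j * (ω i * ω j) := by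
    filter_upwards [hcoord] with ω hω
    rw [hω, hω, mul_mul_mul_comm]
  rw [integral_congr_ae hprod, integral_const_mul, integral_eval_mul_eval_whiteNoise]
  split_ifs with hij
  · rw [hij, mul_one, pow_two]
  · rw [mul_zero]

end GaussianSeries

section GaussianHilbert

variable {H : Type*} [NormedAddCommGroup H] [InnerProductSpace ℝ H] [MeasurableSpace H]
  [BorelSpace H]

lemma isGaussian_of_map_inner [CompleteSpace H] {μ : Measure H} (v : H → NNReal)
    (h : ∀ t : H, μ.map (fun x => inner ℝ t x) = gaussianReal 0 (v t)) : IsGaussian μ := by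
  refine isGaussian_of_map_eq_gaussianReal fun L =>
    ⟨0, v ((InnerProductSpace.toDual ℝ H).symm L), ?_⟩
  rw [← h]
  congr 1
  ext x
  rw [InnerProductSpace.toDual_symm_apply]

lemma integral_inner_of_map_inner {μ : Measure H} {t : H} {v : NNReal}
    (h : μ.map (fun x => inner ℝ t x) = gaussianReal 0 v) : ∫ x, inner ℝ t x ∂μ = 0 := by
  have hint := integral_map (μ := μ) (φ := fun x : H => inner ℝ t x) (f := fun y : ℝ => y)
    (by fun_prop) (by fun_prop)
  rw [← hint, h, integral_id_gaussianReal]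

lemma charFun_map_toLp_inner {ι : Type*} [Fintype ι] (v : ι → H) (ρ : Measure H)
    (t : EuclideanSpace ℝ ι) :
    charFun (ρ.map fun x => WithLp.toLp 2 fun i => inner ℝ (v i) x) t =
      charFun ρ (∑ i, t i • v i) := by
  rw [charFun_apply, charFun_apply, integral_map (by fun_prop) (by fun_prop)]
  simp [inner_sum, inner_smul_right, PiLp.inner_apply, real_inner_comm]

variable {μ : Measure H} [IsGaussian μ]

variable (μ) in
lemma memLp_inner (t : H) : MemLp (fun x => inner ℝ t x) 2 μ :=
  IsGaussian.memLp_dual μ (innerSL ℝ t) 2 (by simp)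

lemma map_inner_of_isGaussian {t : H} (h : ∫ x, inner ℝ t x ∂μ = 0) :
    μ.map (fun x => inner ℝ t x) = gaussianReal 0 (∫ x, inner ℝ t x ^ 2 ∂μ).toNNReal := by
  rw [← variance_of_integral_eq_zero (memLp_inner μ t).aemeasurable h, ← h]
  exact IsGaussian.map_eq_gaussianReal (innerSL ℝ t)

lemma charFun_eq_of_isGaussian {t : H} (h : ∫ x, inner ℝ t x ∂μ = 0) :
    charFun μ t = Complex.exp (-((∫ x, inner ℝ t x ^ 2 ∂μ : ℝ) : ℂ) / 2) := by
  have hmap : charFun (μ.map fun x => inner ℝ t x) 1 = charFun μ t := by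
    rw [charFun_apply, charFun_apply, integral_map (by fun_prop) (by fun_prop)]
    simp [real_inner_comm]
  rw [← hmap, map_inner_of_isGaussian h, charFun_gaussianReal,
    Real.coe_toNNReal _ (integral_nonneg fun x => sq_nonneg _)]
  simp [neg_div]

lemma integral_sq_inner_sum {ι : Type*} [Fintype ι] (v : ι → H) (a : ι → ℝ) :
    ∫ x, inner ℝ (∑ i, a i • v i) x ^ 2 ∂μ =
      ∑ i, ∑ j, a i * a j * ∫ x, inner ℝ (v i) x * inner ℝ (v j) x ∂μ := by
  have hint (i j : ι) : Integrable (fun x => inner ℝ (v i) x * inner ℝ (v j) x) μ :=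
    (memLp_inner μ (v i)).integrable_mul (memLp_inner μ (v j))
  simp only [sum_inner, inner_smul_left, RCLike.conj_to_real, pow_two, Finset.sum_mul_sum,
    mul_mul_mul_comm]
  rw [integral_finsetSum _ fun i _ => integrable_finsetSum _ fun j _ => (hint i j).const_mul _]
  refine Finset.sum_congr rfl fun i _ => ?_
  rw [integral_finsetSum _ fun j _ => (hint i j).const_mul _]
  simp only [integral_const_mul]

end GaussianHilbert

section HilbertBasis

variable {ι H : Type*} [NormedAddCommGroup H] [InnerProductSpace ℝ H] (b : HilbertBasis ι ℝ H)

/-- The partial sum of the expansion of `x` in a Hilbert basis, i.e. the orthogonal projection of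
`x` to the span of finitely many basis vectors. -/
def partialSum (S : Finset ι) (x : H) : H := ∑ i ∈ S, inner ℝ (b i) x • b i

lemma continuous_partialSum (S : Finset ι) : Continuous (partialSum b S) := by
  unfold partialSum
  fun_prop

lemma inner_sub_partialSum [DecidableEq ι] (S : Finset ι) (x : H) (i : ι) :
    inner ℝ (b i) (x - partialSum b S x) = if i ∈ S then 0 else inner ℝ (b i) x := by
  rw [inner_sub_right, partialSum, inner_sum]
  simp only [inner_smul_right, orthonormal_iff_ite.1 b.orthonormal, mul_ite, mul_one, mul_zero,
    Finset.sum_ite_eq]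
  split_ifs <;> simp

lemma hasSum_sq_inner (x : H) : HasSum (fun i => inner ℝ (b i) x ^ 2) (‖x‖ ^ 2) := by
  simpa only [real_inner_comm (b _) x, ← pow_two, real_inner_self_eq_norm_sq]
    using b.hasSum_inner_mul_inner x x

lemma enorm_sub_partialSum_sq (S : Finset ι) (x : H) :
    ‖x - partialSum b S x‖ₑ ^ 2 = ∑' i : {i // i ∉ S}, ‖inner ℝ (b i) x‖ₑ ^ 2 := by
  classical
  have hcoord (i : {i // i ∉ S}) :
      inner ℝ (b i) (x - partialSum b S x) ^ 2 = inner ℝ (b i) x ^ 2 := by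
    rw [inner_sub_partialSum, if_neg i.2]
  have hsum : HasSum (fun i : {i // i ∉ S} => inner ℝ (b i) x ^ 2)
      (‖x - partialSum b S x‖ ^ 2) := by
    simp only [← hcoord]
    refine (hasSum_subtype_iff_of_support_subset (s := {i | i ∉ S}) fun i hi hiS => hi ?_).2
      (hasSum_sq_inner b _)
    simp [inner_sub_partialSum, hiS]
  calc ‖x - partialSum b S x‖ₑ ^ 2 = ENNReal.ofReal (‖x - partialSum b S x‖ ^ 2) := by
        rw [← ofReal_norm, ENNReal.ofReal_pow (norm_nonneg _)]
    _ = ∑' i : {i // i ∉ S}, ENNReal.ofReal (inner ℝ (b i) x ^ 2) := by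
        rw [← hsum.tsum_eq, ENNReal.ofReal_tsum_of_nonneg (fun i => sq_nonneg _) hsum.summable]
    _ = ∑' i : {i // i ∉ S}, ‖inner ℝ (b i) x‖ₑ ^ 2 := by
        refine tsum_congr fun i => ?_
        rw [Real.enorm_eq_ofReal_abs, ← ENNReal.ofReal_pow (abs_nonneg _), sq_abs]

variable [MeasurableSpace H] [BorelSpace H] [Countable ι] [SecondCountableTopology H]

lemma lintegral_enorm_sub_partialSum_le {μ : Measure H} [IsProbabilityMeasure μ] {D : ι → ℝ≥0∞}
    (hμ : ∀ i, ∫⁻ x, ‖inner ℝ (b i) x‖ₑ ^ 2 ∂μ ≤ D i) (S : Finset ι) :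
    ∫⁻ x, ‖x - partialSum b S x‖ₑ ∂μ ≤ (∑' i : {i // i ∉ S}, D i) ^ (1 / 2 : ℝ) := by
  have hm : AEStronglyMeasurable (fun x => x - partialSum b S x) μ :=
    (continuous_id.sub (continuous_partialSum b S)).aestronglyMeasurable
  calc ∫⁻ x, ‖x - partialSum b S x‖ₑ ∂μ
      ≤ (∫⁻ x, ‖x - partialSum b S x‖ₑ ^ 2 ∂μ) ^ (1 / 2 : ℝ) := by
        simpa [eLpNorm_one_eq_lintegral_enorm, eLpNorm_eq_lintegral_rpow_enorm_toReal] using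
          eLpNorm_le_eLpNorm_of_exponent_le one_le_two hm
    _ = (∑' i : {i // i ∉ S}, ∫⁻ x, ‖inner ℝ (b i) x‖ₑ ^ 2 ∂μ) ^ (1 / 2 : ℝ) := by
        simp only [enorm_sub_partialSum_sq]
        rw [lintegral_tsum fun i => by fun_prop]
    _ ≤ (∑' i : {i // i ∉ S}, D i) ^ (1 / 2 : ℝ) := by
        gcongr with i
        exact hμ i

lemma edist_integral_partialSum_le {μ : Measure H} [IsProbabilityMeasure μ] {D : ι → ℝ≥0∞}
    (hμ : ∀ i, ∫⁻ x, ‖inner ℝ (b i) x‖ₑ ^ 2 ∂μ ≤ D i) {F : BoundedContinuousFunction H ℝ}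
    {K : NNReal} (hF : LipschitzWith K F) (S : Finset ι) :
    edist (∫ x, F x ∂μ) (∫ x, F (partialSum b S x) ∂μ) ≤
      K * (∑' i : {i // i ∉ S}, D i) ^ (1 / 2 : ℝ) := by
  have hint : Integrable (fun x => F (partialSum b S x)) μ :=
    (F.compContinuous ⟨_, continuous_partialSum b S⟩).integrable μ
  rw [edist_eq_enorm_sub, ← integral_sub (F.integrable μ) hint]
  calc ‖∫ x, (F x - F (partialSum b S x)) ∂μ‖ₑ
      ≤ ∫⁻ x, ‖F x - F (partialSum b S x)‖ₑ ∂μ := enorm_integral_le_lintegral_enorm _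
    _ ≤ ∫⁻ x, K * ‖x - partialSum b S x‖ₑ ∂μ := by
        refine lintegral_mono fun x => ?_
        simpa only [edist_eq_enorm_sub] using hF.edist_le_mul x (partialSum b S x)
    _ ≤ K * (∑' i : {i // i ∉ S}, D i) ^ (1 / 2 : ℝ) := by
        rw [lintegral_const_mul' _ _ ENNReal.coe_ne_top]
        gcongr
        exact lintegral_enorm_sub_partialSum_le b hμ S

variable {κ : Type*} {l : Filter κ} [l.IsCountablyGenerated] {ν : κ → ProbabilityMeasure H}
  {μ : ProbabilityMeasure H}

lemma tendsto_integral_partialSum {S : Finset ι}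
    (h : ∀ a : S → ℝ, Tendsto (fun k => charFun (ν k : Measure H) (∑ i, a i • b i)) l
      (𝓝 (charFun (μ : Measure H) (∑ i, a i • b i)))) (F : BoundedContinuousFunction H ℝ) :
    Tendsto (fun k => ∫ x, F (partialSum b S x) ∂(ν k : Measure H)) l
      (𝓝 (∫ x, F (partialSum b S x) ∂(μ : Measure H))) := by
  let p : C(H, EuclideanSpace ℝ S) := ⟨fun x => WithLp.toLp 2 fun i : S => inner ℝ (b i) x,
    by fun_prop⟩
  let q : C(EuclideanSpace ℝ S, H) := ⟨fun y => ∑ i, y i • b i, by fun_prop⟩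
  have hq (x : H) : q (p x) = partialSum b S x :=
    Finset.sum_coe_sort S fun i => inner ℝ (b i) x • b i
  have hlim : Tendsto (fun k => (ν k).map p.continuous.aemeasurable) l
      (𝓝 (μ.map p.continuous.aemeasurable)) := by
    refine tendsto_of_seq_tendsto fun k hk =>
      ProbabilityMeasure.tendsto_of_tendsto_charFun fun t => ?_
    simpa only [Function.comp_def, ProbabilityMeasure.toMeasure_map, p, ContinuousMap.coe_mk,
      charFun_map_toLp_inner] using (h t).comp hk
  have hint (ρ : Measure H) : ∫ y, F (q y) ∂(ρ.map p) = ∫ x, F (partialSum b S x) ∂ρ := by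
    rw [integral_map (by fun_prop) (by fun_prop)]
    simp only [hq]
  simpa [hint] using
    ProbabilityMeasure.tendsto_iff_forall_integral_tendsto.1 hlim (F.compContinuous q)

lemma tendsto_of_tendsto_charFun {D : ι → ℝ≥0∞} (hD : ∑' i, D i ≠ ∞)
    (hν : ∀ k i, ∫⁻ x, ‖inner ℝ (b i) x‖ₑ ^ 2 ∂(ν k : Measure H) ≤ D i)
    (hμ : ∀ i, ∫⁻ x, ‖inner ℝ (b i) x‖ₑ ^ 2 ∂(μ : Measure H) ≤ D i)
    (h : ∀ (S : Finset ι) (a : S → ℝ),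
      Tendsto (fun k => charFun (ν k : Measure H) (∑ i, a i • b i)) l
        (𝓝 (charFun (μ : Measure H) (∑ i, a i • b i)))) :
    Tendsto ν l (𝓝 μ) := by
  refine tendsto_iff_forall_lipschitz_integral_tendsto.2 fun F hF ⟨K, hK⟩ => ?_
  obtain ⟨C, hC⟩ := hF
  let F' : BoundedContinuousFunction H ℝ := .mkOfBound ⟨F, hK.continuous⟩ C hC
  have htail : Tendsto (fun S : Finset ι => K * (∑' i : {i // i ∉ S}, D i) ^ (1 / 2 : ℝ)) atTop
      (𝓝 0) := by
    have := (ENNReal.tendsto_tsum_compl_atTop_zero hD).ennrpow_const (1 / 2)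
    simpa using ENNReal.Tendsto.const_mul this (.inr ENNReal.coe_ne_top)
  refine EMetric.tendsto_nhds.2 fun ε hε => ?_
  have hε3 : 0 < ε / 3 := ENNReal.div_pos hε.ne' (by simp)
  obtain ⟨S, hS⟩ := ((tendsto_order.1 htail).2 _ hε3).exists
  have hclose {ρ : ProbabilityMeasure H}
      (hρ : ∀ i, ∫⁻ x, ‖inner ℝ (b i) x‖ₑ ^ 2 ∂(ρ : Measure H) ≤ D i) :
      edist (∫ x, F x ∂(ρ : Measure H)) (∫ x, F (partialSum b S x) ∂(ρ : Measure H)) < ε / 3 :=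
    (edist_integral_partialSum_le b hρ (F := F') hK S).trans_lt hS
  filter_upwards [EMetric.tendsto_nhds.1 (tendsto_integral_partialSum b (h S) F') _ hε3] with k hk
  calc _ ≤ _ := edist_triangle4 _ _ _ _
    _ < ε / 3 + ε / 3 + ε / 3 := ENNReal.add_lt_add (ENNReal.add_lt_add (hclose (hν k)) hk)
        (by rw [edist_comm]; exact hclose hμ)
    _ = ε := ENNReal.add_thirds ε

lemma tendsto_of_isGaussian [∀ k, IsGaussian (ν k : Measure H)] [IsGaussian (μ : Measure H)]
    (hν₀ : ∀ k t, ∫ x, inner ℝ t x ∂(ν k : Measure H) = 0)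
    (hμ₀ : ∀ t, ∫ x, inner ℝ t x ∂(μ : Measure H) = 0) {D : ι → ℝ} (hD : Summable D)
    (hν : ∀ k i, ∫ x, inner ℝ (b i) x ^ 2 ∂(ν k : Measure H) ≤ D i)
    (hcov : ∀ i j, Tendsto (fun k => ∫ x, inner ℝ (b i) x * inner ℝ (b j) x ∂(ν k : Measure H)) l
      (𝓝 (∫ x, inner ℝ (b i) x * inner ℝ (b j) x ∂(μ : Measure H)))) :
    Tendsto ν l (𝓝 μ) := by
  rcases l.eq_or_neBot with rfl | hl
  · exact tendsto_bot
  have hμ (i : ι) : ∫ x, inner ℝ (b i) x ^ 2 ∂(μ : Measure H) ≤ D i := by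
    simp only [pow_two] at hν ⊢
    exact le_of_tendsto' (hcov i i) fun k => hν k i
  have hofReal {ρ : ProbabilityMeasure H} [IsGaussian (ρ : Measure H)] {i : ι}
      (h : ∫ x, inner ℝ (b i) x ^ 2 ∂(ρ : Measure H) ≤ D i) :
      ∫⁻ x, ‖inner ℝ (b i) x‖ₑ ^ 2 ∂(ρ : Measure H) ≤ ENNReal.ofReal (D i) := by
    rw [lintegral_enorm_sq (memLp_inner _ _)]
    exact ENNReal.ofReal_le_ofReal h
  refine tendsto_of_tendsto_charFun b hD.tsum_ofReal_ne_top (fun k i => hofReal (hν k i))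
    (fun i => hofReal (hμ i)) fun S a => ?_
  have hvar : Tendsto (fun k => ∫ x, inner ℝ (∑ i, a i • b i) x ^ 2 ∂(ν k : Measure H)) l
      (𝓝 (∫ x, inner ℝ (∑ i, a i • b i) x ^ 2 ∂(μ : Measure H))) := by
    simp only [integral_sq_inner_sum]
    exact tendsto_finsetSum _ fun i _ => tendsto_finsetSum _ fun j _ => (hcov i j).const_mul _
  simp only [charFun_eq_of_isGaussian (hν₀ _ _), charFun_eq_of_isGaussian (hμ₀ _)]
  have hexp : Continuous fun v : ℝ => Complex.exp (-(v : ℂ) / 2) := by fun_prop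
  exact (hexp.tendsto _).comp hvar

end HilbertBasis

section DiscreteFourier

variable {d n : ℕ} [NeZero n]

lemma discChar_comm (w z : DTorus d n) : discChar w z = discChar z w := by
  simp only [discChar, mul_comm]

lemma discChar_zero_left (z : DTorus d n) : discChar 0 z = 1 := by
  simp [discChar]

lemma discChar_add_right (w x y : DTorus d n) :
    discChar w (x + y) = discChar w x * discChar w y := by
  simp [discChar, add_mul, Finset.sum_add_distrib, AddChar.map_add_eq_mul]

lemma discChar_neg_right (w z : DTorus d n) : discChar w (-z) = conj (discChar w z) := by
  simp only [discChar, Pi.neg_apply, neg_mul, Finset.sum_neg_distrib, AddChar.map_neg_eq_conj]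

lemma discChar_sub_right (w x y : DTorus d n) :
    discChar w (x - y) = discChar w x * conj (discChar w y) := by
  rw [sub_eq_add_neg, discChar_add_right, discChar_neg_right]

lemma discChar_neg_left (w z : DTorus d n) : discChar (-w) z = conj (discChar w z) := by
  rw [discChar_comm, discChar_neg_right, discChar_comm]

lemma discChar_single_right (w : DTorus d n) (i : Fin d) :
    discChar w (Pi.single i 1) = ZMod.stdAddChar (w i) := by
  simp [discChar, Pi.single_apply]

lemma sum_discChar_of_ne_zero {w : DTorus d n} (hw : w ≠ 0) : ∑ z, discChar w z = 0 := by
  let χ : AddChar (DTorus d n) ℂ :=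
    { toFun := discChar w
      map_zero_eq_one' := by rw [discChar_comm, discChar_zero_left]
      map_add_eq_mul' := discChar_add_right w }
  obtain ⟨i, hi⟩ := Function.ne_iff.1 hw
  refine AddChar.sum_eq_zero_of_ne_one (ψ := χ) fun hχ => hi (ZMod.injective_stdAddChar ?_)
  calc ZMod.stdAddChar (w i) = χ (Pi.single i 1) := (discChar_single_right w i).symm
    _ = ZMod.stdAddChar (0 : ZMod n) := by rw [hχ, AddChar.one_apply, AddChar.map_zero_eq_one]

lemma sum_discChar (w : DTorus d n) :
    ∑ z, discChar w z = if w = 0 then (n : ℂ) ^ d else 0 := by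
  split_ifs with hw
  · simp [hw, discChar_zero_left, ZMod.card]
  · exact sum_discChar_of_ne_zero hw

lemma discInner_add_left (f g h : DTorus d n → ℂ) :
    discInner (f + g) h = discInner f h + discInner g h := by
  simp only [discInner, Pi.add_apply, add_mul, Finset.sum_add_distrib, mul_add]

lemma discInner_sub_left (f g h : DTorus d n → ℂ) :
    discInner (f - g) h = discInner f h - discInner g h := by
  simp only [discInner, Pi.sub_apply, sub_mul, Finset.sum_sub_distrib, mul_sub]

lemma discInner_const_mul_left (c : ℂ) (f h : DTorus d n → ℂ) :
    discInner (fun x => c * f x) h = c * discInner f h := by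
  simp only [discInner, mul_assoc c, ← Finset.mul_sum]
  rw [mul_left_comm]

lemma discInner_sum_left {ι : Type*} (S : Finset ι) (c : ι → ℂ) (f : ι → DTorus d n → ℂ)
    (h : DTorus d n → ℂ) :
    discInner (fun x => ∑ i ∈ S, c i * f i x) h = ∑ i ∈ S, c i * discInner (f i) h := by
  simp only [← discInner_const_mul_left]
  simp only [discInner, Finset.sum_mul, ← Finset.mul_sum]
  rw [Finset.sum_comm]

lemma discInner_discChar_zero (f : DTorus d n → ℂ) :
    discInner f (discChar 0) = ((n : ℂ) ^ d)⁻¹ * ∑ x, f x := by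
  simp only [discInner, discChar_zero_left, map_one, mul_one]

lemma discInner_discChar (w v : DTorus d n) :
    discInner (discChar w) (discChar v) = if w = v then 1 else 0 := by
  have h z : discChar w z * conj (discChar v z) = discChar (w - v) z := by
    simp only [discChar_comm _ z, discChar_sub_right]
  simp only [discInner, h, sum_discChar, sub_eq_zero]
  split_ifs
  · exact inv_mul_cancel₀ (pow_ne_zero _ (NeZero.ne _))
  · exact mul_zero _

lemma sum_discInner_mul_discChar (f : DTorus d n → ℂ) (x : DTorus d n) :
    ∑ ν, discInner f (discChar ν) * discChar ν x = f x := by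
  have h ν z : f z * (conj (discChar ν z) * discChar ν x) = f z * discChar (x - z) ν := by
    rw [discChar_comm (x - z), discChar_sub_right, mul_comm (conj _)]
  simp only [discInner, mul_assoc, Finset.sum_mul, ← Finset.mul_sum, h]
  rw [Finset.sum_comm]
  simp only [← Finset.mul_sum, sum_discChar, sub_eq_zero, mul_ite, mul_zero, Finset.sum_ite_eq,
    Finset.mem_univ, if_true]
  rw [mul_comm (f x), inv_mul_cancel_left₀ (pow_ne_zero _ (NeZero.ne _))]

lemma ext_discInner {f g : DTorus d n → ℂ}
    (h : ∀ w, discInner f (discChar w) = discInner g (discChar w)) : f = g := by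
  ext x
  rw [← sum_discInner_mul_discChar f, ← sum_discInner_mul_discChar g]
  simp only [h]

lemma discInner_discFracLaplacian (t : ℝ) (f : DTorus d n → ℂ) {w : DTorus d n} (hw : w ≠ 0) :
    discInner (discFracLaplacian t f) (discChar w) =
      ((-eigenvalue w) ^ (-t) : ℝ) * discInner f (discChar w) := by
  unfold discFracLaplacian
  simp [discInner_sum_left, discInner_discChar, hw]

lemma discInner_discFracLaplacian_zero (t : ℝ) (f : DTorus d n → ℂ) :
    discInner (discFracLaplacian t f) (discChar 0) = 0 := by
  unfold discFracLaplacian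
  simp [discInner_sum_left, discInner_discChar]

end DiscreteFourier

section GraphLaplacian

variable {d n : ℕ} {𝕜 : Type*} [Field 𝕜]

/-- The operator taking the mean of a function over the `2d` neighbours of each vertex, so that the
graph Laplacian is `neighborMean - 1`. -/
def neighborMean : (DTorus d n → 𝕜) →ₗ[𝕜] DTorus d n → 𝕜 where
  toFun f x := (2 * (d : 𝕜))⁻¹ * ∑ i, (f (x + Pi.single i 1) + f (x - Pi.single i 1))
  map_add' f g := by
    ext x
    simp only [Pi.add_apply, ← mul_add, ← Finset.sum_add_distrib, add_add_add_comm]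
  map_smul' c f := by
    ext x
    simp only [Pi.smul_apply, smul_eq_mul, ← mul_add, ← Finset.mul_sum, RingHom.id_apply,
      mul_left_comm c]

lemma neighborMean_apply (f : DTorus d n → 𝕜) (x : DTorus d n) :
    neighborMean f x =
      (2 * (d : 𝕜))⁻¹ * ∑ i, (f (x + Pi.single i 1) + f (x - Pi.single i 1)) := rfl

lemma neighborMean_mono : Monotone (neighborMean : (DTorus d n → ℝ) → DTorus d n → ℝ) :=
  fun _ _ h _ => mul_le_mul_of_nonneg_left
    (Finset.sum_le_sum fun _ _ => add_le_add (h _) (h _)) (by positivity)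

lemma neighborMean_const [CharZero 𝕜] (hd : d ≠ 0) (c : 𝕜) :
    neighborMean (fun _ : DTorus d n => c) = fun _ => c := by
  have hd' : (d : 𝕜) ≠ 0 := Nat.cast_ne_zero.2 hd
  ext x
  simp only [neighborMean_apply, Finset.sum_const, Finset.card_univ, Fintype.card_fin,
    nsmul_eq_mul]
  field_simp
  ring

lemma neighborMean_ofReal (f : DTorus d n → ℝ) (x : DTorus d n) :
    neighborMean (fun y => (f y : ℂ)) x = (neighborMean f x : ℝ) := by
  simp [neighborMean_apply]

lemma neighborMean_re (f : DTorus d n → ℂ) (x : DTorus d n) :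
    neighborMean (fun y => (f y).re) x = (neighborMean f x).re := by
  have h : (2 * (d : ℂ))⁻¹ = ((2 * (d : ℝ))⁻¹ : ℝ) := by push_cast; rfl
  simp only [neighborMean_apply, h, Complex.re_ofReal_mul, Complex.re_sum, Complex.add_re]

variable [NeZero n]

lemma sum_neighborMean [CharZero 𝕜] (hd : d ≠ 0) (f : DTorus d n → 𝕜) :
    ∑ x, neighborMean f x = ∑ x, f x := by
  have hd' : (d : 𝕜) ≠ 0 := Nat.cast_ne_zero.2 hd
  have hadd (e : DTorus d n) : ∑ x, f (x + e) = ∑ x, f x := Equiv.sum_comp (Equiv.addRight e) f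
  have hsub (e : DTorus d n) : ∑ x, f (x - e) = ∑ x, f x := Equiv.sum_comp (Equiv.subRight e) f
  simp only [neighborMean_apply, ← Finset.mul_sum]
  rw [Finset.sum_comm]
  simp only [Finset.sum_add_distrib, hadd, hsub, Finset.sum_const, Finset.card_univ,
    Fintype.card_fin, nsmul_eq_mul]
  field_simp
  ring

lemma stdAddChar_add_conj (a : ZMod n) :
    ZMod.stdAddChar a + conj (ZMod.stdAddChar a) =
      ((2 - 4 * Real.sin (Real.pi * a.val / n) ^ 2 : ℝ) : ℂ) := by
  have h : ZMod.stdAddChar a =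
      Complex.exp ((2 * (Real.pi * a.val / n) : ℝ) * Complex.I) := by
    have ha := ZMod.stdAddChar_coe (N := n) (a.val : ℤ)
    rw [Int.cast_natCast, ZMod.natCast_zmod_val] at ha
    rw [ha]
    congr 1
    push_cast
    ring
  rw [Complex.add_conj, h, Complex.exp_ofReal_mul_I_re, Real.cos_two_mul, Real.cos_sq']
  ring_nf

lemma eigenvalue_neg (w : DTorus d n) : eigenvalue (-w) = eigenvalue w := by
  have h (a : ZMod n) : Real.sin (Real.pi * (-a).val / n) ^ 2 =
      Real.sin (Real.pi * a.val / n) ^ 2 := by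
    have hneg := stdAddChar_add_conj (-a)
    rw [← AddChar.map_neg_eq_conj, neg_neg, add_comm, AddChar.map_neg_eq_conj,
      stdAddChar_add_conj, Complex.ofReal_inj] at hneg
    linarith
  simp only [eigenvalue, Pi.neg_apply, h]

lemma neighborMean_discChar (hd : d ≠ 0) (w : DTorus d n) :
    neighborMean (discChar w) = ((1 + eigenvalue w : ℝ) : ℂ) • discChar w := by
  have hd' : (d : ℂ) ≠ 0 := Nat.cast_ne_zero.2 hd
  have h (x : DTorus d n) (i : Fin d) :
      discChar w (x + Pi.single i 1) + discChar w (x - Pi.single i 1) =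
        discChar w x * (2 - 4 * Real.sin (Real.pi * (w i).val / n) ^ 2 : ℝ) := by
    rw [discChar_add_right, discChar_sub_right, ← mul_add, discChar_single_right,
      stdAddChar_add_conj]
  ext x
  simp only [neighborMean_apply, h, ← Finset.mul_sum, ← Complex.ofReal_sum,
    Finset.sum_sub_distrib, Finset.sum_const, Finset.card_univ, Fintype.card_fin, nsmul_eq_mul,
    Pi.smul_apply, smul_eq_mul, eigenvalue]
  push_cast
  field_simp
  ring

lemma discInner_neighborMean (hd : d ≠ 0) (f : DTorus d n → ℂ) (w : DTorus d n) :
    discInner (neighborMean f) (discChar w) =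
      ((1 + eigenvalue w : ℝ) : ℂ) * discInner f (discChar w) := by
  have h : neighborMean f = fun x => ∑ ν,
      (discInner f (discChar ν) * (1 + eigenvalue ν : ℝ)) * discChar ν x := by
    have hf : f = ∑ ν, discInner f (discChar ν) • discChar ν := by
      ext x
      simp [sum_discInner_mul_discChar f x]
    ext x
    conv_lhs => rw [hf]
    simp [neighborMean_discChar hd, mul_assoc]
  rw [h, discInner_sum_left]
  simp [discInner_discChar, mul_comm]

lemma two_div_le_sin {n t : ℝ} (ht : 1 ≤ t) (htn : t + 1 ≤ n) :
    2 / n ≤ Real.sin (Real.pi * t / n) := by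
  have hn : 0 < n := by linarith
  have key {t : ℝ} (h1 : 1 ≤ t) (h2 : t ≤ n / 2) : 2 / n ≤ Real.sin (Real.pi * t / n) := by
    have hx : Real.pi * t / n ≤ Real.pi / 2 := by
      rw [div_le_div_iff₀ hn two_pos]
      nlinarith [Real.pi_pos]
    calc 2 / n ≤ 2 * t / n := by gcongr; linarith
      _ = 2 / Real.pi * (Real.pi * t / n) := by field_simp
      _ ≤ Real.sin (Real.pi * t / n) := Real.mul_le_sin (by positivity) hx
  rcases le_total t (n / 2) with h | h
  · exact key ht h
  · have := key (t := n - t) (by linarith) (by linarith)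
    rwa [mul_sub, sub_div, mul_div_cancel_right₀ _ hn.ne', Real.sin_pi_sub] at this

lemma le_neg_eigenvalue {w : DTorus d n} (hw : w ≠ 0) :
    4 / (2 * (d : ℝ)) * (2 / n) ^ 2 ≤ -eigenvalue w := by
  obtain ⟨i, hi : w i ≠ 0⟩ := Function.ne_iff.1 hw
  have h1 : (1 : ℝ) ≤ (w i).val :=
    Nat.one_le_cast.2 (Nat.one_le_iff_ne_zero.2 ((ZMod.val_ne_zero _).2 hi))
  have h2 : ((w i).val : ℝ) + 1 ≤ n := by exact_mod_cast ZMod.val_lt (w i)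
  rw [eigenvalue, neg_mul, neg_neg]
  refine mul_le_mul_of_nonneg_left ?_ (by positivity)
  calc (2 / (n : ℝ)) ^ 2 ≤ Real.sin (Real.pi * (w i).val / n) ^ 2 := by
        gcongr
        exact two_div_le_sin h1 h2
    _ ≤ ∑ j, Real.sin (Real.pi * (w j).val / n) ^ 2 :=
        Finset.single_le_sum (f := fun j => Real.sin (Real.pi * (w j).val / n) ^ 2)
          (fun j _ => sq_nonneg _) (Finset.mem_univ i)

lemma neg_eigenvalue_pos (hd : d ≠ 0) {w : DTorus d n} (hw : w ≠ 0) : 0 < -eigenvalue w := by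
  have : 0 < d := Nat.pos_of_ne_zero hd
  have : 0 < n := Nat.pos_of_ne_zero (NeZero.ne n)
  exact lt_of_lt_of_le (by positivity) (le_neg_eigenvalue hw)

lemma discFracLaplacian_one_sub_neighborMean (hd : d ≠ 0) {g : DTorus d n → ℂ}
    (hg : ∑ x, g x = 0) :
    discFracLaplacian 1 g - neighborMean (discFracLaplacian 1 g) = g := by
  refine ext_discInner fun w => ?_
  rw [discInner_sub_left, discInner_neighborMean hd]
  rcases eq_or_ne w 0 with rfl | hw
  · rw [discInner_discFracLaplacian_zero, discInner_discChar_zero, hg]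
    simp only [mul_zero, sub_zero]
  · have hne : (eigenvalue w : ℂ) ≠ 0 := by
      exact_mod_cast (neg_ne_zero.1 (neg_eigenvalue_pos hd hw).ne')
    rw [discInner_discFracLaplacian 1 g hw, Real.rpow_neg_one]
    push_cast
    field_simp
    ring

lemma exists_sub_neighborMean_eq (hd : d ≠ 0) {g : DTorus d n → ℝ} (hg : ∑ x, g x = 0) :
    ∃ f : DTorus d n → ℝ, f - neighborMean f = g := by
  have hg' : ∑ x, (g x : ℂ) = 0 := by exact_mod_cast hg
  refine ⟨fun x => (discFracLaplacian 1 (fun x => (g x : ℂ)) x).re, funext fun x => ?_⟩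
  rw [Pi.sub_apply, neighborMean_re, ← Complex.sub_re, ← Pi.sub_apply,
    discFracLaplacian_one_sub_neighborMean hd hg', Complex.ofReal_re]

end GraphLaplacian

section Odometer

variable {d n : ℕ}

lemma topple_eq (η : DTorus d n → ℝ) :
    topple η = η - excess η + neighborMean (excess η) := rfl

lemma excess_nonneg (η : DTorus d n → ℝ) : 0 ≤ excess η := fun _ => le_max_right _ _

/-- The mass emitted during the first `t` time steps, as a function of the vertex. -/
def partialOdometer (s : DTorus d n → ℝ) (t : ℕ) : DTorus d n → ℝ :=
  ∑ k ∈ Finset.range t, excess (topple^[k] s)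

lemma partialOdometer_apply (s : DTorus d n → ℝ) (t : ℕ) (x : DTorus d n) :
    partialOdometer s t x = ∑ k ∈ Finset.range t, emission s x k :=
  Finset.sum_apply _ _ _

lemma partialOdometer_succ (s : DTorus d n → ℝ) (t : ℕ) :
    partialOdometer s (t + 1) = partialOdometer s t + excess (topple^[t] s) :=
  Finset.sum_range_succ _ _

lemma topple_iterate (s : DTorus d n → ℝ) (t : ℕ) :
    topple^[t] s = s - partialOdometer s t + neighborMean (partialOdometer s t) := by
  induction t with
  | zero => simp [partialOdometer]
  | succ t ih =>
    rw [Function.iterate_succ_apply', topple_eq, partialOdometer_succ, map_add]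
    nth_rw 1 [ih]
    abel

/-- The least action principle for parallel toppling: `f` may prescribe illegal topplings. -/
lemma partialOdometer_le {s f : DTorus d n → ℝ} (hf : 0 ≤ f) (hs : s - f + neighborMean f ≤ 1)
    (t : ℕ) : partialOdometer s t ≤ f := by
  induction t with
  | zero => exact hf
  | succ t ih =>
    intro x
    rw [partialOdometer_succ, Pi.add_apply, excess, ← le_sub_iff_add_le', max_le_iff]
    refine ⟨?_, sub_nonneg.2 (ih x)⟩
    have h1 := neighborMean_mono ih x
    have h2 := hs x
    simp only [topple_iterate, Pi.add_apply, Pi.sub_apply, Pi.one_apply] at h2 ⊢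
    linarith

variable [NeZero n]

lemma summable_emission (hd : d ≠ 0) {s : DTorus d n → ℝ} (hs : ∑ x, (s x - 1) = 0)
    (x : DTorus d n) : Summable (emission s x) := by
  obtain ⟨f, hf⟩ := exists_sub_neighborMean_eq hd hs
  obtain ⟨m, hm⟩ := (Set.finite_range f).bddBelow
  have hM : neighborMean (f - fun _ => m) = neighborMean f - fun _ => m := by
    rw [map_sub, neighborMean_const hd]
  have hle := partialOdometer_le (s := s) (f := f - fun _ => m)
    (fun y => sub_nonneg.2 (hm ⟨y, rfl⟩)) fun y => by
      have hy : f y - neighborMean f y = s y - 1 := congrFun hf y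
      simp only [hM, Pi.add_apply, Pi.sub_apply, Pi.one_apply]
      linarith
  refine summable_of_sum_range_le (c := f x - m) (fun t => excess_nonneg _ x) fun t => ?_
  rw [← partialOdometer_apply]
  exact hle t x

lemma tendsto_partialOdometer (hd : d ≠ 0) {s : DTorus d n → ℝ} (hs : ∑ x, (s x - 1) = 0) :
    Tendsto (partialOdometer s) atTop (𝓝 (odometer s)) := by
  refine tendsto_pi_nhds.2 fun x => ?_
  simp only [partialOdometer_apply]
  exact (summable_emission hd hs x).hasSum.tendsto_sum_nat

lemma odometer_sub_neighborMean_ge (hd : d ≠ 0) {s : DTorus d n → ℝ}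
    (hs : ∑ x, (s x - 1) = 0) (x : DTorus d n) :
    s x - 1 ≤ odometer s x - neighborMean (odometer s) x := by
  have hcont : Continuous (neighborMean : (DTorus d n → ℝ) →ₗ[ℝ] DTorus d n → ℝ) :=
    LinearMap.continuous_of_finiteDimensional _
  have hu := tendsto_partialOdometer hd hs
  have hη : Tendsto (fun t => topple^[t] s) atTop
      (𝓝 (s - odometer s + neighborMean (odometer s))) := by
    simp only [topple_iterate]
    exact (tendsto_const_nhds.sub hu).add ((hcont.tendsto _).comp hu)
  have hle := le_of_tendsto_of_tendsto' ((tendsto_pi_nhds.1 hη x).sub_const 1)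
    (summable_emission hd hs x).tendsto_atTop_zero fun t => le_max_left _ _
  simp only [Pi.add_apply, Pi.sub_apply] at hle
  linarith

lemma odometer_sub_neighborMean (hd : d ≠ 0) {s : DTorus d n → ℝ} (hs : ∑ x, (s x - 1) = 0) :
    odometer s - neighborMean (odometer s) = fun x => s x - 1 := by
  have hsum : ∑ x, (s x - 1) = ∑ x, (odometer s x - neighborMean (odometer s) x) := by
    rw [Finset.sum_sub_distrib (f := odometer s), sum_neighborMean hd, sub_self, hs]
  ext x
  exact ((Finset.sum_eq_sum_iff_of_le fun y _ => odometer_sub_neighborMean_ge hd hs y).1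
    hsum x (Finset.mem_univ x)).symm

lemma sum_initialConfig_sub_one (σ : DTorus d n → ℝ) : ∑ x, (initialConfig σ x - 1) = 0 := by
  have hn : (n : ℝ) ^ d ≠ 0 := pow_ne_zero _ (NeZero.ne _)
  have h x : initialConfig σ x - 1 = σ x - ((n : ℝ) ^ d)⁻¹ * ∑ z, σ z := by
    rw [initialConfig]
    ring
  simp only [h, Finset.sum_sub_distrib, Finset.sum_const, Finset.card_univ, Fintype.card_pi,
    ZMod.card, Finset.prod_const, Fintype.card_fin, nsmul_eq_mul, Nat.cast_pow,
    mul_inv_cancel_left₀ hn, sub_self]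

lemma discInner_const_left (c : ℂ) {w : DTorus d n} (hw : w ≠ 0) :
    discInner (fun _ => c) (discChar w) = 0 := by
  simp only [discInner, ← discChar_neg_left, ← Finset.mul_sum,
    sum_discChar_of_ne_zero (neg_ne_zero.2 hw), mul_zero]

lemma discInner_odometer (hd : d ≠ 0) (σ : DTorus d n → ℝ) {w : DTorus d n} (hw : w ≠ 0) :
    discInner (fun x => (odometer (initialConfig σ) x : ℂ)) (discChar w) =
      ((-eigenvalue w)⁻¹ : ℝ) * discInner (fun x => (σ x : ℂ)) (discChar w) := by
  set u : DTorus d n → ℂ := fun x => (odometer (initialConfig σ) x : ℂ)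
  have hu : u - neighborMean u =
      (fun x => (σ x : ℂ)) - fun _ => ((((n : ℝ) ^ d)⁻¹ * ∑ z, σ z : ℝ) : ℂ) := by
    ext x
    have hx := congrFun (odometer_sub_neighborMean hd (sum_initialConfig_sub_one σ)) x
    rw [Pi.sub_apply, initialConfig, add_sub_assoc, add_sub_cancel_left] at hx
    rw [Pi.sub_apply, Pi.sub_apply, neighborMean_ofReal, ← Complex.ofReal_sub, hx,
      Complex.ofReal_sub]
  have hne : (eigenvalue w : ℂ) ≠ 0 := by
    exact_mod_cast neg_ne_zero.1 (neg_eigenvalue_pos hd hw).ne'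
  have hσ := congrArg (discInner · (discChar w)) hu
  simp only [discInner_sub_left, discInner_neighborMean hd, discInner_const_left _ hw,
    sub_zero] at hσ
  rw [← hσ]
  push_cast
  field_simp
  ring

end Odometer

section FourierCoeff

variable {d : ℕ}

lemma norm_mFourier_apply (ξ : Fin d → ℤ) (x : Torus d) : ‖UnitAddTorus.mFourier ξ x‖ = 1 := by
  simp only [UnitAddTorus.mFourier, ContinuousMap.coe_mk, fourier_apply, norm_prod,
    Circle.norm_coe, Finset.prod_const_one]

lemma integrable_mFourier_mul {f : Torus d → ℝ} (hf : Integrable f (torusMeasure d))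
    (ξ : Fin d → ℤ) :
    Integrable (fun x => UnitAddTorus.mFourier ξ x * (f x : ℂ)) (torusMeasure d) :=
  hf.ofReal.bdd_mul (c := 1) (UnitAddTorus.mFourier ξ).continuous.aestronglyMeasurable
    (.of_forall fun x => (norm_mFourier_apply ξ x).le)

lemma fourierCoeff_eq_integral (f : Torus d → ℝ) (ξ : Fin d → ℤ) :
    fourierCoeff f ξ = ∫ x, UnitAddTorus.mFourier (-ξ) x * (f x : ℂ) ∂torusMeasure d := rfl

lemma fourierCoeff_const_mul (b : ℝ) (f : Torus d → ℝ) (ξ : Fin d → ℤ) :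
    fourierCoeff (fun x => b * f x) ξ = b * fourierCoeff f ξ := by
  simp only [fourierCoeff_eq_integral, Complex.ofReal_mul, mul_left_comm _ (b : ℂ),
    integral_const_mul]

lemma fourierCoeff_sum {ι : Type*} (S : Finset ι) (c : ι → ℝ) {f : ι → Torus d → ℝ}
    (hf : ∀ i ∈ S, Integrable (f i) (torusMeasure d)) (ξ : Fin d → ℤ) :
    fourierCoeff (fun x => ∑ i ∈ S, c i * f i x) ξ = ∑ i ∈ S, c i * fourierCoeff (f i) ξ := by
  simp only [← fourierCoeff_const_mul]
  simp only [fourierCoeff_eq_integral, Complex.ofReal_sum, Finset.mul_sum]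
  exact integral_finsetSum _ fun i hi => integrable_mFourier_mul ((hf i hi).const_mul _) _

end FourierCoeff

section Interpolation

lemma integral_exp_mul_mul_I (a ρ : ℝ) :
    ∫ t in -ρ..ρ, Complex.exp ((a * t : ℝ) * Complex.I) = (2 * ρ * Real.sinc (a * ρ) : ℝ) := by
  rcases eq_or_ne a 0 with rfl | ha
  · simp [← two_mul]
  · rw [intervalIntegral.integral_comp_mul_left (fun t : ℝ => Complex.exp (t * Complex.I)) ha,
      mul_neg, integral_exp_mul_I_eq_sinc, Complex.real_smul]
    have ha' : (a : ℂ) ≠ 0 := Complex.ofReal_ne_zero.2 ha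
    push_cast
    field_simp

lemma preimage_ball_zero_inter_Ioc {ρ : ℝ} (hρ : ρ ≤ 1 / 2) :
    ((↑) : ℝ → UnitAddCircle) ⁻¹' Metric.ball 0 ρ ∩ Set.Ioc (-(1 / 2)) (-(1 / 2) + 1) =
      Set.Ioo (-ρ) ρ := by
  have hnorm {t : ℝ} (ht : |t| ≤ 1 / 2) : ‖(t : UnitAddCircle)‖ = |t| :=
    (AddCircle.norm_coe_eq_abs_iff (p := 1) one_ne_zero).2 (by rwa [abs_one])
  ext t
  rw [Set.mem_inter_iff, Set.mem_preimage, mem_ball_zero_iff, Set.mem_Ioc, Set.mem_Ioo, ← abs_lt]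
  constructor
  · rintro ⟨h, h1, h2⟩
    rwa [← hnorm (abs_le.2 ⟨h1.le, by linarith⟩)]
  · intro h
    have h' := abs_lt.1 h
    exact ⟨by rwa [hnorm (h.le.trans hρ)], by linarith, by linarith⟩

lemma setIntegral_ball_zero_fourier (k : ℤ) {ρ : ℝ} (hρ₀ : 0 ≤ ρ) (hρ : ρ ≤ 1 / 2) :
    ∫ x in Metric.ball 0 ρ, fourier k x ∂AddCircle.haarAddCircle (T := 1) =
      (2 * ρ * Real.sinc (2 * Real.pi * k * ρ) : ℝ) := by
  have hμ : AddCircle.haarAddCircle (T := 1) =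
      (volume.restrict (Set.Ioc (-(1 / 2) : ℝ) (-(1 / 2) + 1))).map (↑) := by
    rw [(UnitAddCircle.measurePreserving_mk (-(1 / 2))).map_eq,
      AddCircle.volume_eq_smul_haarAddCircle, ENNReal.ofReal_one, one_smul]
  have hmeas : Measurable ((↑) : ℝ → UnitAddCircle) := AddCircle.measurable_mk'
  rw [hμ, setIntegral_map Metric.isOpen_ball.measurableSet
    (fourier k).continuous.aestronglyMeasurable hmeas.aemeasurable,
    Measure.restrict_restrict (hmeas Metric.isOpen_ball.measurableSet),
    preimage_ball_zero_inter_Ioc hρ, ← integral_Ioc_eq_integral_Ioo,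
    ← intervalIntegral.integral_of_le (by linarith), ← integral_exp_mul_mul_I]
  refine intervalIntegral.integral_congr fun t _ => ?_
  rw [fourier_coe_apply]
  congr 1
  push_cast
  ring

lemma setIntegral_ball_fourier (k : ℤ) (c : UnitAddCircle) {ρ : ℝ} (hρ₀ : 0 ≤ ρ)
    (hρ : ρ ≤ 1 / 2) :
    ∫ x in Metric.ball c ρ, fourier k x ∂AddCircle.haarAddCircle =
      fourier k c * (2 * ρ * Real.sinc (2 * Real.pi * k * ρ) : ℝ) := by
  have hpre : (c + ·) ⁻¹' Metric.ball c ρ = Metric.ball (0 : UnitAddCircle) ρ := by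
    ext x
    simp [dist_eq_norm]
  rw [← (measurePreserving_add_left AddCircle.haarAddCircle c).setIntegral_preimage_emb
    (measurableEmbedding_addLeft c), hpre, ← setIntegral_ball_zero_fourier k hρ₀ hρ,
    ← integral_const_mul]
  simp only [fourier_apply, smul_add, AddCircle.toCircle_add, Circle.coe_mul]

variable {d : ℕ}

lemma setIntegral_ball_mFourier (ξ : Fin d → ℤ) (c : Torus d) {ρ : ℝ} (hρ₀ : 0 < ρ)
    (hρ : ρ ≤ 1 / 2) :
    ∫ x in Metric.ball c ρ, UnitAddTorus.mFourier ξ x ∂torusMeasure d =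
      UnitAddTorus.mFourier ξ c *
        (∏ i, 2 * ρ * Real.sinc (2 * Real.pi * ξ i * ρ) : ℝ) := by
  rw [ball_pi c hρ₀, torusMeasure, Measure.restrict_pi_pi]
  refine (integral_fintype_prod_eq_prod (𝕜 := ℂ) fun i x => fourier (ξ i) x).trans ?_
  simp only [setIntegral_ball_fourier _ _ hρ₀.le hρ]
  rw [Finset.prod_mul_distrib, ← Complex.ofReal_prod]
  rfl

lemma fourierCoeff_indicator_ball (ξ : Fin d → ℤ) (c : Torus d) {ρ : ℝ} (hρ₀ : 0 < ρ)
    (hρ : ρ ≤ 1 / 2) :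
    fourierCoeff ((Metric.ball c ρ).indicator fun _ => 1) ξ =
      conj (UnitAddTorus.mFourier ξ c) *
        (∏ i, 2 * ρ * Real.sinc (2 * Real.pi * ξ i * ρ) : ℝ) := by
  have h (x : Torus d) : UnitAddTorus.mFourier (-ξ) x *
      ((Metric.ball c ρ).indicator (fun _ => 1) x : ℝ) =
        (Metric.ball c ρ).indicator (UnitAddTorus.mFourier (-ξ)) x := by
    by_cases hx : x ∈ Metric.ball c ρ <;> simp [hx]
  rw [fourierCoeff_eq_integral]
  simp only [h]
  rw [integral_indicator Metric.isOpen_ball.measurableSet,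
    setIntegral_ball_mFourier _ _ hρ₀ hρ, UnitAddTorus.mFourier_neg]
  simp only [Pi.neg_apply, Int.cast_neg, mul_neg, neg_mul, Real.sinc_neg]

/-- The reduction of a frequency modulo `n`. -/
def freqMod (n : ℕ) (ξ : Fin d → ℤ) : DTorus d n := fun i => (ξ i : ZMod n)

/-- The Fourier multiplier relating a function on the discrete torus to its interpolation, i.e.
the normalized Fourier transform of the indicator of a cube of side `1/n`. -/
def sincProd (n : ℕ) (ξ : Fin d → ℤ) : ℝ := ∏ i, Real.sinc (Real.pi * ξ i / n)

lemma abs_sincProd_le_one (n : ℕ) (ξ : Fin d → ℤ) : |sincProd n ξ| ≤ 1 := by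
  rw [sincProd, Finset.abs_prod]
  exact Finset.prod_le_one (fun i _ => abs_nonneg _) fun i _ => Real.abs_sinc_le_one _

lemma tendsto_sincProd (ξ : Fin d → ℤ) : Tendsto (fun n => sincProd n ξ) atTop (𝓝 1) := by
  rw [← Finset.prod_const_one (s := (Finset.univ : Finset (Fin d)))]
  refine tendsto_finsetProd _ fun i _ => ?_
  rw [← Real.sinc_zero]
  exact (Real.continuous_sinc.tendsto 0).comp
    (tendsto_const_nhds.div_atTop tendsto_natCast_atTop_atTop)

variable {n : ℕ} [NeZero n]

lemma sincProd_eq_zero {ξ : Fin d → ℤ} (hξ : ξ ≠ 0) (h : freqMod n ξ = 0) :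
    sincProd n ξ = 0 := by
  obtain ⟨i, hi : ξ i ≠ 0⟩ := Function.ne_iff.1 hξ
  obtain ⟨m, hm⟩ := (ZMod.intCast_zmod_eq_zero_iff_dvd (ξ i) n).1 (congrFun h i)
  have hn : (n : ℝ) ≠ 0 := Nat.cast_ne_zero.2 (NeZero.ne n)
  have hm₀ : (m : ℝ) ≠ 0 := Int.cast_ne_zero.2 fun h0 => hi (by rw [hm, h0, mul_zero])
  have hπ : Real.pi * ξ i / n = m * Real.pi := by
    rw [hm]
    push_cast
    field_simp
  refine Finset.prod_eq_zero (Finset.mem_univ i) ?_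
  rw [hπ, Real.sinc_of_ne_zero (mul_ne_zero hm₀ Real.pi_ne_zero), Real.sin_int_mul_pi, zero_div]

lemma fourier_toAddCircle (k : ℤ) (j : ZMod n) :
    fourier k (ZMod.toAddCircle j) = ZMod.stdAddChar (j * (k : ZMod n)) := by
  have h : j * (k : ZMod n) = (((j.val : ℤ) * k : ℤ) : ZMod n) := by
    push_cast
    rw [ZMod.natCast_zmod_val]
  rw [h, ZMod.stdAddChar_coe, ZMod.toAddCircle_apply, fourier_coe_apply]
  congr 1
  push_cast
  ring

lemma mFourier_toAddCircle (ξ : Fin d → ℤ) (z : DTorus d n) :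
    UnitAddTorus.mFourier ξ (fun i => ZMod.toAddCircle (z i)) = discChar (freqMod n ξ) z := by
  have h := map_sum (ZMod.stdAddChar (N := n)).toAddMonoidHom
    (fun i => z i * freqMod n ξ i) Finset.univ
  change ∏ i, fourier (ξ i) (ZMod.toAddCircle (z i)) = _
  simp only [fourier_toAddCircle, discChar]
  exact (congrArg Additive.toMul h).symm

lemma fourierCoeff_interpolation (u : DTorus d n → ℝ) (ξ : Fin d → ℤ) :
    fourierCoeff (interpolation u) ξ =
      sincProd n ξ * discInner (fun x => (u x : ℂ)) (discChar (freqMod n ξ)) := by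
  have hn : (1 : ℝ) ≤ n := Nat.one_le_cast.2 (NeZero.one_le)
  have hρ : 1 / (2 * (n : ℝ)) ≤ 1 / 2 := one_div_le_one_div_of_le two_pos (by linarith)
  have hcube : (∏ i, 2 * (1 / (2 * (n : ℝ))) * Real.sinc (2 * Real.pi * ξ i * (1 / (2 * n)))) =
      ((n : ℝ) ^ d)⁻¹ * sincProd n ξ := by
    have hside : 2 * (1 / (2 * (n : ℝ))) = (n : ℝ)⁻¹ := by field_simp
    have harg (k : ℤ) : 2 * Real.pi * k * (1 / (2 * n)) = Real.pi * k / n := by field_simp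
    simp only [hside, harg, Finset.prod_mul_distrib, Finset.prod_const, Finset.card_univ,
      Fintype.card_fin, inv_pow, sincProd]
  unfold interpolation
  rw [fourierCoeff_sum _ _ fun z _ =>
    (integrable_const (1 : ℝ)).indicator Metric.isOpen_ball.measurableSet]
  simp only [fourierCoeff_indicator_ball ξ _ (by positivity : 0 < 1 / (2 * (n : ℝ))) hρ, hcube,
    mFourier_toAddCircle, discInner, Finset.mul_sum]
  refine Finset.sum_congr rfl fun z _ => ?_
  push_cast
  ring

end Interpolation

section Frequencies

variable {d : ℕ}

lemma freqNorm_pos (ξ : Freq d) : 0 < freqNorm ξ := zero_lt_one.trans_le (one_le_freqNorm ξ)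

lemma freqNorm_opp (ξ : Freq d) : freqNorm ξ.opp = freqNorm ξ := by
  simp [freqNorm, Freq.opp]

lemma freqNorm_sq (ξ : Freq d) : freqNorm ξ ^ 2 = ∑ i, (ξ.1 i : ℝ) ^ 2 :=
  Real.sq_sqrt (Finset.sum_nonneg fun _ _ => sq_nonneg _)

lemma weight_eq_rpow (s a : ℝ) (ξ : Freq d) : weight s a ξ = freqNorm ξ ^ (4 * a - 4 * s) := by
  rw [weight, multiplier, ← Real.rpow_add (freqNorm_pos ξ), neg_add_eq_sub]

lemma norm_intCast_le_freqNorm (ξ : Freq d) : ‖fun i => (ξ.1 i : ℝ)‖ ≤ freqNorm ξ :=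
  (pi_norm_le_iff_of_nonneg (freqNorm_pos ξ).le).2 fun i => Real.abs_le_sqrt
    (Finset.single_le_sum (f := fun i => (ξ.1 i : ℝ) ^ 2) (fun _ _ => sq_nonneg _)
      (Finset.mem_univ i))

lemma summable_freqNorm_rpow {p : ℝ} (hp : p < -d) : Summable fun ξ : Freq d => freqNorm ξ ^ p := by
  let L : Submodule ℤ (Fin d → ℝ) := Submodule.span ℤ (Set.range (Pi.basisFun ℝ (Fin d)))
  have hrank : Module.finrank ℤ L = d := by
    rw [ZLattice.rank ℝ L, Module.finrank_fin_fun]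
  have hmem (ξ : Freq d) : (fun i => (ξ.1 i : ℝ)) ∈ L := by
    have h : (fun i => (ξ.1 i : ℝ)) = ∑ i, ξ.1 i • Pi.basisFun ℝ (Fin d) i := by
      ext j
      simp [Pi.single_apply]
    rw [h]
    exact Submodule.sum_mem _ fun i _ => Submodule.smul_mem _ _ (Submodule.subset_span ⟨i, rfl⟩)
  let e (ξ : Freq d) : L := ⟨_, hmem ξ⟩
  have hcoord (ξ : Freq d) (i : Fin d) : (e ξ).1 i = ξ.1 i := rfl
  have he : Function.Injective e := fun ξ η h => Subtype.ext <| funext fun i => by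
    have := congrFun (congrArg Subtype.val h) i
    rwa [hcoord, hcoord, Int.cast_inj] at this
  have hpos (ξ : Freq d) : 0 < ‖e ξ‖ := by
    refine norm_pos_iff.2 fun h => ξ.2 (funext fun i => ?_)
    have := congrFun (congrArg Subtype.val h) i
    rwa [hcoord, ZeroMemClass.coe_zero, Pi.zero_apply, Int.cast_eq_zero] at this
  refine ((ZLattice.summable_norm_rpow L p (by rwa [hrank])).comp_injective he).of_nonneg_of_le
    (fun ξ => Real.rpow_nonneg (freqNorm_pos ξ).le _) fun ξ => ?_
  have hp₀ : p ≤ 0 := hp.le.trans (neg_nonpos.2 d.cast_nonneg)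
  exact Real.rpow_le_rpow_of_nonpos (hpos ξ) (norm_intCast_le_freqNorm ξ) hp₀

end Frequencies

section SmoothFunctions

variable {d : ℕ}

/-- The covering map `ℝ^d → 𝕋^d`. -/
def torusMk (y : Fin d → ℝ) : Torus d := fun i => (y i : UnitAddCircle)

lemma isOpenQuotientMap_torusMk : IsOpenQuotientMap (torusMk (d := d)) :=
  IsOpenQuotientMap.piMap fun _ => QuotientAddGroup.isOpenQuotientMap_mk

lemma torusMk_add_single (y : Fin d → ℝ) (i : Fin d) (h : ℝ) :
    torusMk y + Pi.single i (h : UnitAddCircle) = torusMk (y + h • Pi.single i 1) := by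
  ext j
  rcases eq_or_ne j i with rfl | hj
  · simp [torusMk]
  · simp [torusMk, hj]

/-- The partial derivative of a function on the torus. -/
def torusDeriv (i : Fin d) (f : Torus d → ℝ) (x : Torus d) : ℝ :=
  deriv (fun h : ℝ => f (x + Pi.single i (h : UnitAddCircle))) 0

/-- The Laplacian of a function on the torus. -/
def torusLaplacian (f : Torus d → ℝ) (x : Torus d) : ℝ := ∑ i, torusDeriv i (torusDeriv i f) x

variable {f : Torus d → ℝ}

lemma IsSmooth.continuous (hf : IsSmooth f) : Continuous f :=
  isOpenQuotientMap_torusMk.isQuotientMap.continuous_iff.2 (ContDiff.continuous hf)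

lemma IsSmooth.integrable (hf : IsSmooth f) : Integrable f (torusMeasure d) :=
  hf.continuous.integrable_of_hasCompactSupport (HasCompactSupport.of_compactSpace f)

lemma IsSmooth.sum {ι : Type*} (S : Finset ι) (c : ι → ℝ) {f : ι → Torus d → ℝ}
    (hf : ∀ i ∈ S, IsSmooth (f i)) : IsSmooth fun x => ∑ i ∈ S, c i * f i x :=
  ContDiff.sum fun i hi => contDiff_const.mul (hf i hi)

lemma IsSmooth.hasDerivAt_zero (hf : IsSmooth f) (i : Fin d) (y : Fin d → ℝ) :
    HasDerivAt (fun h : ℝ => f (torusMk y + Pi.single i (h : UnitAddCircle)))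
      (fderiv ℝ (fun y => f (torusMk y)) y (Pi.single i 1)) 0 := by
  have hdiff : DifferentiableAt ℝ (fun y => f (torusMk y)) y :=
    (ContDiff.differentiable hf (by simp)).differentiableAt
  simp only [torusMk_add_single]
  exact hdiff.hasFDerivAt.hasLineDerivAt (Pi.single i 1)

lemma IsSmooth.torusDeriv_torusMk (hf : IsSmooth f) (i : Fin d) (y : Fin d → ℝ) :
    torusDeriv i f (torusMk y) = fderiv ℝ (fun y => f (torusMk y)) y (Pi.single i 1) :=
  (hf.hasDerivAt_zero i y).deriv

lemma IsSmooth.hasDerivAt (hf : IsSmooth f) (i : Fin d) (x : Torus d) (h : ℝ) :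
    HasDerivAt (fun h : ℝ => f (x + Pi.single i (h : UnitAddCircle)))
      (torusDeriv i f (x + Pi.single i (h : UnitAddCircle))) h := by
  obtain ⟨y, hy⟩ := isOpenQuotientMap_torusMk.surjective (x + Pi.single i (h : UnitAddCircle))
  have hzero := hf.hasDerivAt_zero i y
  rw [← hf.torusDeriv_torusMk, hy, ← sub_self h] at hzero
  have hshift (k : ℝ) : x + Pi.single i (h : UnitAddCircle) +
      Pi.single i ((k - h : ℝ) : UnitAddCircle) = x + Pi.single i (k : UnitAddCircle) := by
    rw [add_assoc, ← Pi.single_add, ← AddCircle.coe_add, add_sub_cancel]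
  simpa only [hshift] using hzero.comp_sub_const h h

lemma IsSmooth.torusDeriv (hf : IsSmooth f) (i : Fin d) : IsSmooth (torusDeriv i f) := by
  have h : (fun y => Sandpile.torusDeriv i f (torusMk y)) =
      fun y => fderiv ℝ (fun y => f (torusMk y)) y (Pi.single i 1) :=
    funext fun y => hf.torusDeriv_torusMk i y
  change ContDiff ℝ _ (fun y => Sandpile.torusDeriv i f (torusMk y))
  rw [h]
  exact (ContDiff.fderiv_right hf (by simp)).clm_apply contDiff_const

lemma IsSmooth.torusLaplacian (hf : IsSmooth f) : IsSmooth (torusLaplacian f) := by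
  have h := IsSmooth.sum Finset.univ 1 fun i _ => (hf.torusDeriv i).torusDeriv i
  simp only [Pi.one_apply, one_mul] at h
  exact h

end SmoothFunctions

section FourierDecay

variable {d : ℕ} {f : Torus d → ℝ}

lemma mFourier_add_apply (ξ : Fin d → ℤ) (x y : Torus d) :
    UnitAddTorus.mFourier ξ (x + y) = UnitAddTorus.mFourier ξ x * UnitAddTorus.mFourier ξ y := by
  simp [UnitAddTorus.mFourier, fourier_apply, smul_add, AddCircle.toCircle_add,
    Finset.prod_mul_distrib]

lemma mFourier_torusMk (ξ : Fin d → ℤ) (y : Fin d → ℝ) :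
    UnitAddTorus.mFourier ξ (torusMk y) =
      Complex.exp ((2 * Real.pi * ∑ i, ξ i * y i : ℝ) * Complex.I) := by
  change ∏ i, fourier (ξ i) (y i : UnitAddCircle) = _
  simp only [fourier_coe_apply, ← Complex.exp_sum]
  push_cast
  rw [Finset.mul_sum, Finset.sum_mul]
  exact congrArg _ (Finset.sum_congr rfl fun i _ => by ring)

lemma mFourier_pi_single (ξ : Fin d → ℤ) (i : Fin d) (h : ℝ) :
    UnitAddTorus.mFourier ξ (Pi.single i (h : UnitAddCircle)) =
      Complex.exp (2 * Real.pi * Complex.I * ξ i * h) := by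
  have hmk : (Pi.single i (h : UnitAddCircle) : Torus d) = torusMk (Pi.single i h) := by
    ext j
    rcases eq_or_ne j i with rfl | hj
    · simp [torusMk]
    · simp [torusMk, hj]
  rw [hmk, mFourier_torusMk]
  simp only [Pi.single_apply, mul_ite, mul_zero, Finset.sum_ite_eq', Finset.mem_univ, if_true]
  push_cast
  ring_nf

lemma norm_fourierCoeff_le {C : ℝ} (hC : ∀ x, ‖f x‖ ≤ C) (ξ : Fin d → ℤ) :
    ‖fourierCoeff f ξ‖ ≤ C := by
  rw [fourierCoeff_eq_integral]
  refine (norm_integral_le_of_norm_le_const (C := C) (.of_forall fun x => ?_)).trans (by simp)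
  rw [norm_mul, norm_mFourier_apply, one_mul, Complex.norm_real]
  exact hC x

lemma fourierCoeff_translate (f : Torus d → ℝ) (ξ : Fin d → ℤ) (y : Torus d) :
    fourierCoeff (fun x => f (x + y)) ξ = UnitAddTorus.mFourier ξ y * fourierCoeff f ξ := by
  have hinv : (torusMeasure d).IsAddRightInvariant := by
    unfold torusMeasure; infer_instance
  have hinverse : UnitAddTorus.mFourier ξ y * UnitAddTorus.mFourier (-ξ) y = 1 := by
    rw [← UnitAddTorus.mFourier_add, add_neg_cancel, UnitAddTorus.mFourier_zero,
      ContinuousMap.one_apply]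
  rw [fourierCoeff_eq_integral, fourierCoeff_eq_integral, ← integral_const_mul,
    ← integral_add_right_eq_self
      (fun x => UnitAddTorus.mFourier ξ y * (UnitAddTorus.mFourier (-ξ) x * (f x : ℂ))) y]
  refine integral_congr_ae (.of_forall fun x => ?_)
  simp only [mFourier_add_apply]
  linear_combination (-(UnitAddTorus.mFourier (-ξ) x * f (x + y))) * hinverse

lemma IsSmooth.hasDerivAt_fourierCoeff_translate (hf : IsSmooth f) (i : Fin d) (ξ : Fin d → ℤ) :
    HasDerivAt (fun h : ℝ => fourierCoeff (fun x => f (x + Pi.single i (h : UnitAddCircle))) ξ)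
      (fourierCoeff (Sandpile.torusDeriv i f) ξ) 0 := by
  have hcont {g : Torus d → ℝ} (hg : Continuous g) (h : ℝ) : Continuous fun x : Torus d =>
      UnitAddTorus.mFourier (-ξ) x * (g (x + Pi.single i (h : UnitAddCircle)) : ℂ) := by fun_prop
  have hbound (x : Torus d) (h : ℝ) : ‖UnitAddTorus.mFourier (-ξ) x *
      (Sandpile.torusDeriv i f (x + Pi.single i (h : UnitAddCircle)) : ℂ)‖ ≤
        ‖(⟨_, (hf.torusDeriv i).continuous⟩ : C(Torus d, ℝ))‖ := by
    rw [norm_mul, norm_mFourier_apply, one_mul, Complex.norm_real]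
    exact ContinuousMap.norm_coe_le_norm ⟨_, (hf.torusDeriv i).continuous⟩ _
  have hint : Integrable (fun x : Torus d => UnitAddTorus.mFourier (-ξ) x *
      (f (x + Pi.single i ((0 : ℝ) : UnitAddCircle)) : ℂ)) (torusMeasure d) := by
    simpa using integrable_mFourier_mul hf.integrable (-ξ)
  have := (hasDerivAt_integral_of_dominated_loc_of_deriv_le (μ := torusMeasure d) univ_mem
    (.of_forall fun h => (hcont hf.continuous h).aestronglyMeasurable) hint
    (hcont (hf.torusDeriv i).continuous 0).aestronglyMeasurable
    (.of_forall fun x h _ => hbound x h) (integrable_const _)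
    (.of_forall fun x h _ => ((hf.hasDerivAt i x h).ofReal_comp).const_mul _)).2
  simpa [fourierCoeff_eq_integral] using this

lemma IsSmooth.fourierCoeff_torusDeriv (hf : IsSmooth f) (i : Fin d) (ξ : Fin d → ℤ) :
    fourierCoeff (Sandpile.torusDeriv i f) ξ =
      2 * Real.pi * Complex.I * ξ i * fourierCoeff f ξ := by
  have htranslate := hf.hasDerivAt_fourierCoeff_translate i ξ
  simp only [fourierCoeff_translate, mFourier_pi_single] at htranslate
  have hexp : HasDerivAt (fun h : ℝ => Complex.exp (2 * Real.pi * Complex.I * ξ i * h))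
      (2 * Real.pi * Complex.I * ξ i) 0 := by
    simpa using ((Complex.ofRealCLM.hasDerivAt (x := (0 : ℝ))).const_mul
      (2 * Real.pi * Complex.I * ξ i : ℂ)).cexp
  exact htranslate.unique (hexp.mul_const _)

lemma IsSmooth.norm_fourierCoeff_torusLaplacian (hf : IsSmooth f) (ξ : Freq d) :
    ‖fourierCoeff (Sandpile.torusLaplacian f) ξ.1‖ =
      4 * Real.pi ^ 2 * freqNorm ξ ^ 2 * ‖fourierCoeff f ξ.1‖ := by
  have hsum := fourierCoeff_sum Finset.univ 1
    (fun i _ => ((hf.torusDeriv i).torusDeriv i).integrable) ξ.1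
  simp only [Pi.one_apply, one_mul, Complex.ofReal_one,
    (hf.torusDeriv _).fourierCoeff_torusDeriv, hf.fourierCoeff_torusDeriv] at hsum
  have hsymbol : ∑ i, 2 * Real.pi * Complex.I * ξ.1 i *
      (2 * Real.pi * Complex.I * ξ.1 i * fourierCoeff f ξ.1) =
        ((-(4 * Real.pi ^ 2 * freqNorm ξ ^ 2) : ℝ) : ℂ) * fourierCoeff f ξ.1 := by
    rw [freqNorm_sq]
    push_cast
    rw [Finset.mul_sum, ← Finset.sum_neg_distrib, Finset.sum_mul]
    refine Finset.sum_congr rfl fun i _ => ?_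
    linear_combination (4 * Real.pi ^ 2 * (ξ.1 i : ℂ) ^ 2 * fourierCoeff f ξ.1) * Complex.I_sq
  have hpos : 0 ≤ 4 * Real.pi ^ 2 * freqNorm ξ ^ 2 := by positivity
  rw [← abs_of_nonneg hpos, ← abs_neg, ← Real.norm_eq_abs, ← Complex.norm_real, ← norm_mul,
    ← hsymbol]
  exact congrArg norm hsum

lemma IsSmooth.exists_freqNorm_pow_mul_norm_fourierCoeff_le (k : ℕ) :
    ∀ {f : Torus d → ℝ}, IsSmooth f →
      ∃ C, ∀ ξ : Freq d, freqNorm ξ ^ (2 * k) * ‖fourierCoeff f ξ.1‖ ≤ C := by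
  induction k with
  | zero =>
    intro f hf
    refine ⟨‖(⟨f, hf.continuous⟩ : C(Torus d, ℝ))‖, fun ξ => ?_⟩
    rw [mul_zero, pow_zero, one_mul]
    exact norm_fourierCoeff_le (ContinuousMap.norm_coe_le_norm ⟨f, hf.continuous⟩) ξ.1
  | succ k ih =>
    intro f hf
    obtain ⟨C, hC⟩ := ih hf.torusLaplacian
    refine ⟨C, fun ξ => le_trans ?_ (hC ξ)⟩
    have hpi : 1 ≤ 4 * Real.pi ^ 2 := by nlinarith [Real.pi_gt_three]
    calc freqNorm ξ ^ (2 * (k + 1)) * ‖fourierCoeff f ξ.1‖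
        = freqNorm ξ ^ (2 * k) * (1 * freqNorm ξ ^ 2 * ‖fourierCoeff f ξ.1‖) := by ring
      _ ≤ freqNorm ξ ^ (2 * k) * ‖fourierCoeff (Sandpile.torusLaplacian f) ξ.1‖ := by
        have := (freqNorm_pos ξ).le
        rw [hf.norm_fourierCoeff_torusLaplacian]
        gcongr

lemma IsSmooth.summable_rpow_mul_norm_fourierCoeff (hf : IsSmooth f) (p : ℝ) :
    Summable fun ξ : Freq d => freqNorm ξ ^ p * ‖fourierCoeff f ξ.1‖ := by
  obtain ⟨k, hk⟩ := exists_nat_gt (p + d)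
  obtain ⟨C, hC⟩ := exists_freqNorm_pow_mul_norm_fourierCoeff_le k hf
  have hp : p - (2 * k : ℕ) < -d := by
    push_cast
    linarith [(Nat.cast_nonneg k : (0 : ℝ) ≤ k)]
  refine ((summable_freqNorm_rpow hp).mul_left C).of_nonneg_of_le
    (fun ξ => mul_nonneg (Real.rpow_nonneg (freqNorm_pos ξ).le _) (norm_nonneg _)) fun ξ => ?_
  have hpow := Real.rpow_nonneg (freqNorm_pos ξ).le (p - (2 * k : ℕ))
  calc freqNorm ξ ^ p * ‖fourierCoeff f ξ.1‖
      = freqNorm ξ ^ (p - (2 * k : ℕ)) * (freqNorm ξ ^ (2 * k) * ‖fourierCoeff f ξ.1‖) := by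
        rw [← mul_assoc, ← Real.rpow_natCast, ← Real.rpow_add (freqNorm_pos ξ), sub_add_cancel]
    _ ≤ freqNorm ξ ^ (p - (2 * k : ℕ)) * C := by gcongr; exact hC ξ
    _ = C * freqNorm ξ ^ (p - (2 * k : ℕ)) := mul_comm _ _

lemma IsSmooth.summable_rpow_mul_norm_fourierCoeff_sq (hf : IsSmooth f) (p : ℝ) :
    Summable fun ξ : Freq d => freqNorm ξ ^ p * ‖fourierCoeff f ξ.1‖ ^ 2 := by
  let F : C(Torus d, ℝ) := ⟨f, hf.continuous⟩
  refine ((hf.summable_rpow_mul_norm_fourierCoeff p).mul_right ‖F‖).of_nonneg_of_le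
    (fun ξ => mul_nonneg (Real.rpow_nonneg (freqNorm_pos ξ).le _) (sq_nonneg _)) fun ξ => ?_
  have hpow := Real.rpow_nonneg (freqNorm_pos ξ).le p
  rw [sq, ← mul_assoc]
  gcongr
  exact norm_fourierCoeff_le F.norm_coe_le_norm ξ.1

lemma integral_norm_sq_tsum_mFourier {c : Freq d → ℂ} (hc : Summable fun ν => ‖c ν‖) :
    ∫ x, ‖∑' ν : Freq d, c ν * UnitAddTorus.mFourier ν.1 x‖ ^ 2 ∂torusMeasure d =
      ∑' ν, ‖c ν‖ ^ 2 := by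
  obtain ⟨G, hG⟩ : Summable fun ν : Freq d => c ν • (UnitAddTorus.mFourier ν.1 : C(Torus d, ℂ)) :=
    .of_norm (by simpa [norm_smul, UnitAddTorus.mFourier_norm] using hc)
  have hGx (x : Torus d) : ∑' ν : Freq d, c ν * UnitAddTorus.mFourier ν.1 x = G x :=
    (hG.mapL (ContinuousMap.evalCLM ℂ x)).tsum_eq
  have hLp : HasSum (fun ν : Freq d => c ν • UnitAddTorus.mFourierLp 2 ν.1)
      (ContinuousMap.toLp 2 (torusMeasure d) ℂ G) :=
    hG.mapL (ContinuousMap.toLp 2 (torusMeasure d) ℂ)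
  have hnorm : ‖ContinuousMap.toLp 2 (torusMeasure d) ℂ G‖ ^ 2 =
      ∫ x, ‖G x‖ ^ 2 ∂torusMeasure d := by
    rw [← inner_self_eq_norm_sq (𝕜 := ℂ), ContinuousMap.inner_toLp]
    simp only [RCLike.mul_conj]
    norm_cast
  simp only [hGx]
  exact hnorm.symm.trans (norm_sq_eq_tsum_of_hasSum_orthonormal
    (UnitAddTorus.orthonormal_mFourier.comp _ Subtype.val_injective) hLp)

lemma IsSmooth.integral_norm_sq_fracLaplacian (hf : IsSmooth f) (a : ℝ) :
    ∫ x, ‖fracLaplacian a f x‖ ^ 2 ∂torusMeasure d =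
      ∑' ξ : Freq d, freqNorm ξ ^ (4 * a) * ‖fourierCoeff f ξ.1‖ ^ 2 := by
  have hnorm (ξ : Freq d) : ‖((freqNorm ξ ^ (2 * a) : ℝ) : ℂ) * fourierCoeff f ξ.1‖ =
      freqNorm ξ ^ (2 * a) * ‖fourierCoeff f ξ.1‖ := by
    rw [norm_mul, Complex.norm_real, Real.norm_of_nonneg (Real.rpow_nonneg (freqNorm_pos ξ).le _)]
  simp only [fracLaplacian]
  rw [integral_norm_sq_tsum_mFourier
    (by simpa only [hnorm] using hf.summable_rpow_mul_norm_fourierCoeff (2 * a))]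
  refine tsum_congr fun ξ => ?_
  rw [hnorm, mul_pow, ← Real.rpow_mul_natCast (freqNorm_pos ξ).le]
  congr 2
  push_cast
  ring

end FourierDecay

section HartleyCoeff

lemma conj_one_add_I_div_two : conj ((1 + Complex.I) / 2) = (1 - Complex.I) / 2 := by
  rw [map_div₀, map_add, map_one, Complex.conj_I, map_ofNat, sub_eq_add_neg]

lemma conj_one_sub_I_div_two : conj ((1 - Complex.I) / 2) = (1 + Complex.I) / 2 := by
  rw [map_div₀, map_sub, map_one, Complex.conj_I, map_ofNat, sub_neg_eq_add]

lemma ofReal_re_sub_im (z : ℂ) :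
    ((z.re - z.im : ℝ) : ℂ) = (1 + Complex.I) / 2 * z + (1 - Complex.I) / 2 * conj z := by
  apply Complex.ext <;> simp <;> ring

variable {G : Type*} [InvolutiveNeg G] [DecidableEq G]

/-- The Fourier coefficient at the frequency `v` of the real function `re ψ_w - im ψ_w`, where
`ψ_w` is the character of frequency `w`. -/
def hartleyCoeff (w v : G) : ℂ :=
  (if v = w then (1 + Complex.I) / 2 else 0) + if v = -w then (1 - Complex.I) / 2 else 0

lemma hartleyCoeff_neg_right (w v : G) : hartleyCoeff w (-v) = conj (hartleyCoeff w v) := by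
  simp only [hartleyCoeff, neg_eq_iff_eq_neg, neg_neg, map_add, apply_ite conj, map_zero,
    conj_one_add_I_div_two, conj_one_sub_I_div_two]
  rw [add_comm]

lemma hartleyCoeff_re_add_im (w v : G) :
    (hartleyCoeff w v).re + (hartleyCoeff w v).im = if v = w then 1 else 0 := by
  rw [hartleyCoeff]
  split_ifs <;> simp <;> norm_num

end HartleyCoeff

section Hartley

variable {d : ℕ} {s a : ℝ}

/-- The coordinate `v_ξ = (K̂(ξ) ‖ξ‖^{4a})^{1/2} ĝ(ξ)` of an element `g` of the Sobolev space. -/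
def SobolevSpace.coord (g : SobolevSpace d s a) (ξ : Freq d) : ℂ := (g.1 : Freq d → ℂ) ξ

lemma SobolevSpace.coord_opp (g : SobolevSpace d s a) (ξ : Freq d) :
    g.coord ξ.opp = conj (g.coord ξ) := g.2 ξ

lemma SobolevSpace.ext_coord {g h : SobolevSpace d s a} (H : ∀ ξ, g.coord ξ = h.coord ξ) : g = h :=
  Subtype.ext (lp.ext (funext H))

lemma SobolevSpace.coord_eq (g : SobolevSpace d s a) (ξ : Freq d) :
    g.coord ξ = Real.sqrt (weight s a ξ) * g.coeff ξ := by
  have h : (Real.sqrt (weight s a ξ) : ℂ) ≠ 0 :=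
    Complex.ofReal_ne_zero.2 (Real.sqrt_ne_zero'.2 (weight_pos s a ξ))
  rw [coeff, coord, Complex.ofReal_inv, mul_inv_cancel_left₀ h]

lemma SobolevSpace.coord_sum_smul {ι : Type*} (S : Finset ι) (c : ι → ℝ)
    (g : ι → SobolevSpace d s a) (ξ : Freq d) :
    (∑ i ∈ S, c i • g i).coord ξ = ∑ i ∈ S, c i * (g i).coord ξ := by
  let coordHom : SobolevSpace d s a →+ ℂ := ⟨⟨fun g => g.coord ξ, rfl⟩, fun _ _ => rfl⟩
  exact map_sum coordHom _ _

lemma SobolevSpace.hasSum_inner (g h : SobolevSpace d s a) :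
    HasSum (fun ξ => (h.coord ξ * conj (g.coord ξ)).re) (inner ℝ g h) :=
  lp.hasSum_inner (𝕜 := ℝ) g.1 h.1

/-- The unit vector of the Sobolev space which is a multiple of `cos (2πξ·x) - sin (2πξ·x)`. These
functions are the kernels of the Hartley transform and form a basis over the reals that is
indexed by all frequencies. -/
def hartley (s a : ℝ) (ξ : Freq d) : SobolevSpace d s a :=
  ⟨lp.single 2 ξ ((1 + Complex.I) / 2) + lp.single 2 ξ.opp ((1 - Complex.I) / 2), fun η => by
    have hcoord (ζ : Freq d) : (lp.single 2 ξ ((1 + Complex.I) / 2) + lp.single 2 ξ.opp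
        ((1 - Complex.I) / 2) : lp (fun _ : Freq d => ℂ) 2) ζ = hartleyCoeff ξ.1 ζ.1 := by
      simp [hartleyCoeff, lp.single_apply, Pi.single_apply, Subtype.ext_iff, Freq.opp]
    rw [hcoord, hcoord]
    exact hartleyCoeff_neg_right _ _⟩

lemma coord_hartley (ξ η : Freq d) : (hartley s a ξ).coord η = hartleyCoeff ξ.1 η.1 := by
  simp [SobolevSpace.coord, hartley, hartleyCoeff, lp.single_apply, Pi.single_apply,
    Subtype.ext_iff, Freq.opp]

lemma inner_hartley (ξ : Freq d) (g : SobolevSpace d s a) :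
    inner ℝ (hartley s a ξ) g = (g.coord ξ).re + (g.coord ξ).im := by
  have h : inner ℝ (hartley s a ξ) g = inner ℝ ((1 + Complex.I) / 2) (g.coord ξ) +
      inner ℝ ((1 - Complex.I) / 2) (g.coord ξ.opp) := by
    change inner ℝ (lp.single 2 ξ ((1 + Complex.I) / 2) +
      lp.single 2 ξ.opp ((1 - Complex.I) / 2) : lp (fun _ : Freq d => ℂ) 2) g.1 = _
    rw [inner_add_left, lp.inner_single_left, lp.inner_single_left]
    rfl
  rw [h, g.coord_opp, Complex.inner, Complex.inner, conj_one_add_I_div_two, conj_one_sub_I_div_two]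
  simp only [Complex.mul_re, Complex.div_ofNat_re, Complex.sub_re, Complex.one_re, Complex.I_re,
    sub_zero, one_div, Complex.div_ofNat_im, Complex.sub_im, Complex.one_im, Complex.I_im, zero_sub,
    Complex.conj_re, Complex.add_re, add_zero, Complex.conj_im, Complex.add_im, zero_add, neg_mul,
    sub_neg_eq_add]
  ring

lemma orthonormal_hartley : Orthonormal ℝ (hartley (d := d) s a) := by
  rw [orthonormal_iff_ite]
  intro ξ η
  rw [inner_hartley, coord_hartley, hartleyCoeff_re_add_im]
  simp only [Subtype.ext_iff]

lemma span_hartley_orthogonal :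
    (Submodule.span ℝ (Set.range (hartley (d := d) s a)))ᗮ = ⊥ := by
  rw [Submodule.eq_bot_iff]
  intro g hg
  have h (ξ : Freq d) : (g.coord ξ).re + (g.coord ξ).im = 0 := by
    rw [← inner_hartley]
    exact (Submodule.mem_orthogonal _ _).1 hg _ (Submodule.subset_span ⟨ξ, rfl⟩)
  refine SobolevSpace.ext_coord fun ξ => ?_
  have hopp := h ξ.opp
  rw [g.coord_opp, Complex.conj_re, Complex.conj_im] at hopp
  change g.coord ξ = 0
  apply Complex.ext
  · rw [Complex.zero_re]; linarith [h ξ]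
  · rw [Complex.zero_im]; linarith [h ξ]

/-- The Hartley basis of the Sobolev space. -/
def hartleyBasis (d : ℕ) (s a : ℝ) : HilbertBasis (Freq d) ℝ (SobolevSpace d s a) :=
  HilbertBasis.mkOfOrthogonalEqBot orthonormal_hartley span_hartley_orthogonal

lemma hartleyBasis_apply (ξ : Freq d) : hartleyBasis d s a ξ = hartley s a ξ := by
  rw [hartleyBasis, HilbertBasis.coe_mkOfOrthogonalEqBot]

lemma inner_hartleyBasis (ξ : Freq d) (g : SobolevSpace d s a) :
    inner ℝ (hartleyBasis d s a ξ) g = (g.coord ξ).re + (g.coord ξ).im := by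
  rw [hartleyBasis_apply, inner_hartley]

lemma tsum_sq_re_add_im {v : Freq d → ℂ} (hv : ∀ ξ, v ξ.opp = conj (v ξ))
    (hs : Summable fun ξ => ‖v ξ‖ ^ 2) :
    ∑' ξ, ((v ξ).re + (v ξ).im) ^ 2 = ∑' ξ, ‖v ξ‖ ^ 2 := by
  let g : SobolevSpace d 0 0 := ⟨⟨v, memℓp_gen (by simpa using hs)⟩, hv⟩
  have hnorm := (SobolevSpace.hasSum_inner g g).tsum_eq
  simp only [Complex.mul_conj, Complex.ofReal_re, Complex.normSq_eq_norm_sq,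
    real_inner_self_eq_norm_sq] at hnorm
  refine Eq.trans (tsum_congr fun ξ => ?_) ((hasSum_sq_inner (hartleyBasis d 0 0) g).tsum_eq.trans
    hnorm.symm)
  rw [inner_hartleyBasis]
  rfl

instance : SecondCountableTopology (SobolevSpace d s a) := by
  have hspan := (Set.countable_range (hartleyBasis d s a)).isSeparable.span (R := ℝ)
  have hdense : Dense (Submodule.span ℝ (Set.range (hartleyBasis d s a)) :
      Set (SobolevSpace d s a)) :=
    Submodule.dense_iff_topologicalClosure_eq_top.2 (hartleyBasis d s a).dense_span
  have := TopologicalSpace.isSeparable_univ_iff.1 (hdense.closure_eq ▸ hspan.closure)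
  exact UniformSpace.secondCountable_of_separable _

end Hartley

section Pairing

variable {d : ℕ} {s a : ℝ} {f : Torus d → ℝ}

lemma IsSmooth.summable_weight_mul_sq (hf : IsSmooth f) : Summable fun ξ : Freq d =>
    weight s a ξ * ‖((weight s a ξ)⁻¹ : ℝ) * fourierCoeff f ξ.1‖ ^ 2 := by
  refine (hf.summable_rpow_mul_norm_fourierCoeff_sq (4 * s - 4 * a)).congr fun ξ => ?_
  have hw := weight_pos s a ξ
  have hinv : freqNorm ξ ^ (4 * s - 4 * a) = (weight s a ξ)⁻¹ := by
    rw [weight_eq_rpow, ← Real.rpow_neg (freqNorm_pos ξ).le, neg_sub]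
  rw [hinv, norm_mul, Complex.norm_real, Real.norm_of_nonneg (inv_nonneg.2 hw.le), mul_pow]
  field_simp

/-- The vector of the Sobolev space representing the pairing with the test function `f`. -/
def testVector (s a : ℝ) (hf : IsSmooth f) : SobolevSpace d s a :=
  SobolevSpace.ofCoeff (fun ξ => ((weight s a ξ)⁻¹ : ℝ) * fourierCoeff f ξ.1)
    (fun ξ => by
      have h : fourierCoeff f ξ.opp.1 = conj (fourierCoeff f ξ.1) := fourierCoeff_neg f ξ.1
      rw [weight_opp, h, map_mul, Complex.conj_ofReal])
    hf.summable_weight_mul_sq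

lemma coord_testVector (hf : IsSmooth f) (ξ : Freq d) :
    (testVector s a hf).coord ξ = ((Real.sqrt (weight s a ξ))⁻¹ : ℝ) * fourierCoeff f ξ.1 := by
  rw [SobolevSpace.coord_eq, testVector, SobolevSpace.coeff_ofCoeff, ← mul_assoc,
    ← Complex.ofReal_mul, ← Real.sqrt_div_self, div_eq_mul_inv]

lemma pairing_eq_inner (hf : IsSmooth f) (g : SobolevSpace d s a) :
    SobolevSpace.pairing f g = inner ℝ (testVector s a hf) g := by
  rw [← (SobolevSpace.hasSum_inner _ _).tsum_eq, SobolevSpace.pairing]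
  refine tsum_congr fun ξ => congrArg Complex.re ?_
  rw [coord_testVector, SobolevSpace.coeff, SobolevSpace.coord, map_mul, Complex.conj_ofReal]
  ring

end Pairing

section TrigPolynomials

variable {d : ℕ} {s a : ℝ}

lemma fourierCoeff_zero (f : Torus d → ℝ) : fourierCoeff f 0 = ∫ x, f x ∂torusMeasure d := by
  rw [fourierCoeff_eq_integral, neg_zero, UnitAddTorus.mFourier_zero, ← integral_complex_ofReal]
  simp only [ContinuousMap.one_apply, one_mul]

lemma mFourierCoeff_mFourier (ξ η : Fin d → ℤ) :
    UnitAddTorus.mFourierCoeff (UnitAddTorus.mFourier ξ) η = if η = ξ then 1 else 0 := by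
  rw [← UnitAddTorus.mFourierCoeff_toLp, ← UnitAddTorus.mFourierBasis_repr,
    HilbertBasis.repr_apply_apply, UnitAddTorus.coe_mFourierBasis]
  exact orthonormal_iff_ite.1 UnitAddTorus.orthonormal_mFourier η ξ

/-- The function `cos (2πξ·x) - sin (2πξ·x)`. -/
def cosSubSin (ξ : Fin d → ℤ) (x : Torus d) : ℝ :=
  (UnitAddTorus.mFourier ξ x).re - (UnitAddTorus.mFourier ξ x).im

lemma isSmooth_cosSubSin (ξ : Fin d → ℤ) : IsSmooth (cosSubSin ξ) := by
  change ContDiff ℝ _ (fun y => cosSubSin ξ (torusMk y))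
  simp only [cosSubSin, mFourier_torusMk, Complex.exp_ofReal_mul_I_re,
    Complex.exp_ofReal_mul_I_im]
  fun_prop

lemma fourierCoeff_cosSubSin (ξ η : Fin d → ℤ) :
    fourierCoeff (cosSubSin ξ) η = hartleyCoeff ξ η := by
  have hint (ζ : Fin d → ℤ) : Integrable (fun x => UnitAddTorus.mFourier (-η) x *
      UnitAddTorus.mFourier ζ x) (torusMeasure d) :=
    Continuous.integrable_of_hasCompactSupport (by fun_prop) (HasCompactSupport.of_compactSpace _)
  have hcoeff (ζ : Fin d → ℤ) : ∫ x, UnitAddTorus.mFourier (-η) x * UnitAddTorus.mFourier ζ x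
      ∂torusMeasure d = if η = ζ then 1 else 0 := mFourierCoeff_mFourier ζ η
  rw [fourierCoeff_eq_integral]
  simp only [cosSubSin, ofReal_re_sub_im, ← UnitAddTorus.mFourier_neg, mul_add,
    mul_left_comm (UnitAddTorus.mFourier (-η) _ : ℂ)]
  rw [integral_add ((hint _).const_mul _) ((hint _).const_mul _), integral_const_mul,
    integral_const_mul, hcoeff, hcoeff, hartleyCoeff]
  simp only [mul_ite, mul_one, mul_zero]

lemma testVector_cosSubSin (ξ : Freq d) : testVector s a (isSmooth_cosSubSin ξ.1) =
    (Real.sqrt (weight s a ξ))⁻¹ • hartleyBasis d s a ξ := by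
  refine SobolevSpace.ext_coord fun η => ?_
  have hsmul : ((Real.sqrt (weight s a ξ))⁻¹ • hartleyBasis d s a ξ).coord η =
      ((Real.sqrt (weight s a ξ))⁻¹ : ℝ) * hartleyCoeff ξ.1 η.1 := by
    rw [← coord_hartley (s := s) (a := a), ← hartleyBasis_apply]
    rfl
  rw [coord_testVector, fourierCoeff_cosSubSin, hsmul]
  by_cases hη : η.1 = ξ.1 ∨ η.1 = ξ.opp.1
  · have hweight : weight s a η = weight s a ξ := by
      rcases hη with h | h
      · rw [Subtype.ext h]
      · rw [Subtype.ext h, weight_opp]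
    rw [hweight]
  · rw [not_or] at hη
    have hη₂ : η.1 ≠ -ξ.1 := hη.2
    rw [hartleyCoeff, if_neg hη.1, if_neg hη₂, add_zero, mul_zero, mul_zero]

/-- The mean zero trigonometric polynomial which represents `∑ ξ ∈ S, t ξ • b ξ` for the Hartley
basis `b`. -/
def trigPoly (s a : ℝ) (S : Finset (Freq d)) (t : Freq d → ℝ) (x : Torus d) : ℝ :=
  ∑ ξ ∈ S, (t ξ * Real.sqrt (weight s a ξ)) * cosSubSin ξ.1 x

lemma isSmooth_trigPoly (S : Finset (Freq d)) (t : Freq d → ℝ) : IsSmooth (trigPoly s a S t) :=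
  IsSmooth.sum S _ fun ξ _ => isSmooth_cosSubSin ξ.1

lemma fourierCoeff_trigPoly (S : Finset (Freq d)) (t : Freq d → ℝ) (η : Fin d → ℤ) :
    fourierCoeff (trigPoly s a S t) η = ∑ ξ ∈ S, ((t ξ * Real.sqrt (weight s a ξ) : ℝ) : ℂ) *
      fourierCoeff (cosSubSin ξ.1) η :=
  fourierCoeff_sum S _ (fun ξ _ => (isSmooth_cosSubSin ξ.1).integrable) η

lemma integral_trigPoly (S : Finset (Freq d)) (t : Freq d → ℝ) :
    ∫ x, trigPoly s a S t x ∂torusMeasure d = 0 := by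
  have hzero (ξ : Freq d) : fourierCoeff (cosSubSin ξ.1) 0 = 0 := by
    rw [fourierCoeff_cosSubSin, hartleyCoeff, if_neg ξ.2.symm,
      if_neg (neg_ne_zero.2 ξ.2).symm, add_zero]
  apply Complex.ofReal_injective
  rw [← fourierCoeff_zero, fourierCoeff_trigPoly]
  simp only [hzero, mul_zero, Finset.sum_const_zero, Complex.ofReal_zero]

lemma testVector_trigPoly (S : Finset (Freq d)) (t : Freq d → ℝ) :
    testVector s a (isSmooth_trigPoly (s := s) (a := a) S t) =
      ∑ ξ ∈ S, t ξ • hartleyBasis d s a ξ := by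
  have hbasis (ξ : Freq d) : t ξ • hartleyBasis d s a ξ =
      (t ξ * Real.sqrt (weight s a ξ)) • testVector s a (isSmooth_cosSubSin ξ.1) := by
    rw [testVector_cosSubSin, smul_smul,
      mul_inv_cancel_right₀ (Real.sqrt_ne_zero'.2 (weight_pos s a ξ))]
  refine SobolevSpace.ext_coord fun η => ?_
  simp only [hbasis]
  rw [SobolevSpace.coord_sum_smul, coord_testVector, fourierCoeff_trigPoly, Finset.mul_sum]
  refine Finset.sum_congr rfl fun ξ _ => ?_
  rw [coord_testVector, mul_left_comm]

end TrigPolynomials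

section HartleyTransform

variable {d n : ℕ} [NeZero n]

/-- The real function `cos (2πz·w/n) - sin (2πz·w/n)` on the discrete torus. -/
def discHartley (w z : DTorus d n) : ℝ := (discChar w z).re - (discChar w z).im

lemma discInner_discHartley (w v : DTorus d n) :
    discInner (fun z => (discHartley w z : ℂ)) (discChar v) = hartleyCoeff w v := by
  have h : (fun z => (discHartley w z : ℂ)) = (fun z => (1 + Complex.I) / 2 * discChar w z) +
      fun z => (1 - Complex.I) / 2 * discChar (-w) z := by
    ext z
    rw [Pi.add_apply, discHartley, ofReal_re_sub_im, discChar_neg_left]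
  rw [h, discInner_add_left, discInner_const_mul_left, discInner_const_mul_left,
    discInner_discChar, discInner_discChar, hartleyCoeff]
  simp only [mul_ite, mul_one, mul_zero, eq_comm]

lemma discFracLaplacian_discHartley (t : ℝ) {w : DTorus d n} (hw : w ≠ 0) :
    discFracLaplacian t (fun z => (discHartley w z : ℂ)) =
      fun z => (((-eigenvalue w) ^ (-t) : ℝ) : ℂ) * discHartley w z := by
  refine ext_discInner fun v => ?_
  rw [discInner_const_mul_left, discInner_discHartley]
  by_cases hv : v = 0
  · rw [hv, discInner_discFracLaplacian_zero, hartleyCoeff, if_neg hw.symm,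
      if_neg (neg_ne_zero.2 hw).symm, add_zero, mul_zero]
  rw [discInner_discFracLaplacian _ _ hv, discInner_discHartley]
  by_cases h : v = w ∨ v = -w
  · have hvw : eigenvalue v = eigenvalue w := by
      rcases h with rfl | rfl
      · rfl
      · exact eigenvalue_neg w
    rw [hvw]
  · rw [not_or] at h
    rw [hartleyCoeff, if_neg h.1, if_neg h.2, add_zero, mul_zero, mul_zero]

/-- The Hartley transform on the discrete torus. -/
def hartleyTransform (w : DTorus d n) : (DTorus d n → ℝ) →L[ℝ] ℝ :=
  ∑ z, (((n : ℝ) ^ d)⁻¹ * discHartley w z) • ContinuousLinearMap.proj (R := ℝ) z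

lemma ofReal_hartleyTransform (w : DTorus d n) (f : DTorus d n → ℝ) :
    (hartleyTransform w f : ℂ) =
      discInner (fun z => (f z : ℂ)) (fun z => (discHartley w z : ℂ)) := by
  simp [hartleyTransform, discInner, Finset.mul_sum, mul_left_comm, mul_comm]

lemma hartleyTransform_eq_re_add_im (w : DTorus d n) (f : DTorus d n → ℝ) :
    hartleyTransform w f = (discInner (fun z => (f z : ℂ)) (discChar w)).re +
      (discInner (fun z => (f z : ℂ)) (discChar w)).im := by
  have h : ((n : ℂ) ^ d)⁻¹ = ((((n : ℝ) ^ d)⁻¹ : ℝ) : ℂ) := by push_cast; rfl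
  simp only [hartleyTransform, discInner, h, Finset.mul_sum, Complex.re_sum, Complex.im_sum,
    ← Finset.sum_add_distrib, Complex.re_ofReal_mul, Complex.im_ofReal_mul, Complex.conj_re,
    Complex.conj_im, discHartley, sum_apply, smul_apply,
    ContinuousLinearMap.proj_apply, smul_eq_mul]
  exact Finset.sum_congr rfl fun z _ => by ring

lemma hartleyTransform_discHartley (w v : DTorus d n) :
    hartleyTransform v (discHartley w) = if v = w then 1 else 0 := by
  rw [hartleyTransform_eq_re_add_im, discInner_discHartley, hartleyCoeff_re_add_im]

end HartleyTransform

section Multiplier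

variable {d n : ℕ}

/-- The ratio `a_n / (-λ_ξ)`, which is `0` if `λ_ξ = 0`. -/
def eigenRatio (n : ℕ) (ξ : Fin d → ℤ) : ℝ := scaling d n * (-eigenvalue (freqMod n ξ))⁻¹

lemma scaling_pos (hd : d ≠ 0) (hn : n ≠ 0) : 0 < scaling d n := by
  unfold scaling
  positivity

variable [NeZero n]

lemma sin_sq_val_intCast (k : ℤ) :
    Real.sin (Real.pi * (k : ZMod n).val / n) ^ 2 = Real.sin (Real.pi * k / n) ^ 2 := by
  have h : ZMod.stdAddChar (k : ZMod n) =
      Complex.exp ((2 * (Real.pi * k / n) : ℝ) * Complex.I) := by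
    rw [ZMod.stdAddChar_coe]
    congr 1
    push_cast
    ring
  have hre := stdAddChar_add_conj (k : ZMod n)
  rw [Complex.add_conj, h, Complex.exp_ofReal_mul_I_re, Real.cos_two_mul, Real.cos_sq',
    Complex.ofReal_inj] at hre
  linarith

lemma neg_eigenvalue_freqMod (ξ : Fin d → ℤ) :
    -eigenvalue (freqMod n ξ) =
      scaling d n * ∑ i, (ξ i : ℝ) ^ 2 * Real.sinc (Real.pi * ξ i / n) ^ 2 := by
  have h (k : ℤ) : Real.sin (Real.pi * k / n) ^ 2 =
      Real.pi ^ 2 * ((n : ℝ) ^ 2)⁻¹ * ((k : ℝ) ^ 2 * Real.sinc (Real.pi * k / n) ^ 2) := by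
    have hn : (n : ℝ) ≠ 0 := NeZero.ne _
    by_cases hk : (k : ℝ) = 0
    · simp [hk]
    · rw [Real.sinc_of_ne_zero (by positivity)]
      field_simp
  simp only [eigenvalue, freqMod, sin_sq_val_intCast, h, ← Finset.mul_sum, scaling]
  ring

lemma eigenRatio_eq (hd : d ≠ 0) (ξ : Fin d → ℤ) : eigenRatio n ξ =
    (∑ i, (ξ i : ℝ) ^ 2 * Real.sinc (Real.pi * ξ i / n) ^ 2)⁻¹ := by
  rw [eigenRatio, neg_eigenvalue_freqMod, mul_inv,
    mul_inv_cancel_left₀ (scaling_pos hd (NeZero.ne n)).ne']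

lemma eigenRatio_pos (hd : d ≠ 0) {ξ : Fin d → ℤ} (h : freqMod n ξ ≠ 0) : 0 < eigenRatio n ξ :=
  mul_pos (scaling_pos hd (NeZero.ne n)) (inv_pos.2 (neg_eigenvalue_pos hd h))

lemma scaling_rpow_mul_eigenvalue_rpow (hd : d ≠ 0) {ξ : Fin d → ℤ} (h : freqMod n ξ ≠ 0) (t : ℝ) :
    scaling d n ^ t * (-eigenvalue (freqMod n ξ)) ^ (-t) = eigenRatio n ξ ^ t := by
  have hpos := neg_eigenvalue_pos hd h
  rw [eigenRatio, Real.mul_rpow (scaling_pos hd (NeZero.ne n)).le (inv_nonneg.2 hpos.le),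
    Real.inv_rpow hpos.le, Real.rpow_neg hpos.le]

lemma eigenRatio_le (hd : d ≠ 0) {ξ : Fin d → ℤ} (h : freqMod n ξ ≠ 0) :
    eigenRatio n ξ ≤ Real.pi ^ 2 / 4 := by
  have hd' : (d : ℝ) ≠ 0 := Nat.cast_ne_zero.2 hd
  have hn : (n : ℝ) ≠ 0 := NeZero.ne _
  rw [eigenRatio, ← div_eq_mul_inv, div_le_iff₀ (neg_eigenvalue_pos hd h)]
  refine le_trans (le_of_eq ?_) (mul_le_mul_of_nonneg_left (le_neg_eigenvalue h) (by positivity))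
  rw [scaling]
  field_simp
  norm_num

lemma freqNorm_rpow_le_eigenRatio (hd : d ≠ 0) {ξ : Freq d} (h : freqMod n ξ.1 ≠ 0) :
    freqNorm ξ ^ (-2 : ℝ) ≤ eigenRatio n ξ.1 := by
  have hpos := eigenRatio_pos hd h
  rw [eigenRatio_eq hd, inv_pos] at hpos
  rw [eigenRatio_eq hd, Real.rpow_neg (freqNorm_pos ξ).le, Real.rpow_two, freqNorm_sq]
  refine inv_anti₀ hpos (Finset.sum_le_sum fun i _ => mul_le_of_le_one_right (sq_nonneg _) ?_)
  rw [← sq_abs]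
  exact pow_le_one₀ (abs_nonneg _) (Real.abs_sinc_le_one _)

end Multiplier

lemma tendsto_eigenRatio {d : ℕ} (hd : d ≠ 0) (ξ : Freq d) :
    Tendsto (fun n : ℕ => eigenRatio n ξ.1) atTop (𝓝 (freqNorm ξ ^ (-2 : ℝ))) := by
  have hsinc (k : ℤ) : Tendsto (fun n : ℕ => Real.sinc (Real.pi * k / n)) atTop (𝓝 1) := by
    rw [← Real.sinc_zero]
    exact (Real.continuous_sinc.tendsto 0).comp (tendsto_const_div_atTop_nhds_zero_nat _)
  have hsum : Tendsto (fun n : ℕ => ∑ i, (ξ.1 i : ℝ) ^ 2 * Real.sinc (Real.pi * ξ.1 i / n) ^ 2)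
      atTop (𝓝 (freqNorm ξ ^ 2)) := by
    rw [freqNorm_sq]
    exact tendsto_finsetSum _ fun i _ => by simpa using ((hsinc (ξ.1 i)).pow 2).const_mul _
  rw [Real.rpow_neg (freqNorm_pos ξ).le, Real.rpow_two]
  refine (hsum.inv₀ (pow_pos (freqNorm_pos ξ) 2).ne').congr' ?_
  filter_upwards [eventually_ne_atTop 0] with n hn
  have : NeZero n := ⟨hn⟩
  rw [eigenRatio_eq hd]

section DiscreteField

variable {d n : ℕ} [NeZero n] {Ω : Type*} [MeasurableSpace Ω] {P : Measure Ω}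
  {σ : Ω → DTorus d n → ℝ} {A : (DTorus d n → ℂ) → DTorus d n → ℂ} {s : ℝ}

lemma IsCenteredGaussian.integral_clm (hσ : IsCenteredGaussian P σ A)
    (L : (DTorus d n → ℝ) →L[ℝ] ℝ) : ∫ ω, L (σ ω) ∂P = 0 := by
  have hint := hσ.gaussian.integrable
  have hzero : ∫ ω, σ ω ∂P = 0 := by
    ext x
    rw [eval_integral (Integrable.eval hint)]
    exact hσ.centered x
  rw [L.integral_comp_comm hint, hzero, map_zero]

lemma integral_hartleyTransform_mul (hσ : IsCenteredGaussian P σ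
      (fun f x => ((scaling d n ^ (2 * s) : ℝ) : ℂ) * discFracLaplacian (2 * s) f x))
    {w : DTorus d n} (hw : w ≠ 0) (v : DTorus d n) :
    ∫ ω, hartleyTransform w (σ ω) * hartleyTransform v (σ ω) ∂P =
      if v = w then scaling d n ^ (2 * s) * (-eigenvalue w) ^ (-(2 * s)) else 0 := by
  have h := hσ.covariance (discHartley w) (discHartley v)
  rw [discFracLaplacian_discHartley _ hw, discInner_const_mul_left, discInner_const_mul_left,
    ← ofReal_hartleyTransform, hartleyTransform_discHartley] at h
  simp only [← ofReal_hartleyTransform, ← Complex.ofReal_mul] at h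
  rw [integral_complex_ofReal, Complex.ofReal_inj] at h
  rw [h, mul_ite, mul_ite, mul_one, mul_zero, mul_zero]

end DiscreteField

section OdometerField

variable {d n : ℕ} [NeZero n] {s a : ℝ}

/-- The rescaled and interpolated odometer `a_n Ξ_n` as an element of the Sobolev space. -/
def odometerField (s a : ℝ) (σ : DTorus d n → ℝ) : SobolevSpace d s a :=
  SobolevSpace.ofFun fun x => scaling d n * interpolation (odometer (initialConfig σ)) x

/-- The factor by which the Hartley coordinate of the initial field at `ξ` is multiplied to obtain
that of the odometer field. -/
def fieldCoeff (s a : ℝ) (n : ℕ) (ξ : Freq d) : ℝ :=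
  Real.sqrt (weight s a ξ) * (sincProd n ξ.1 * eigenRatio n ξ.1)

lemma fieldCoeff_eq_zero {ξ : Freq d} (h : freqMod n ξ.1 = 0) : fieldCoeff s a n ξ = 0 := by
  rw [fieldCoeff, sincProd_eq_zero ξ.2 h, zero_mul, mul_zero]

lemma coord_odometerField (hd : d ≠ 0) (ha : a ≤ s) (σ : DTorus d n → ℝ) (ξ : Freq d) :
    (odometerField s a σ).coord ξ =
      fieldCoeff s a n ξ * discInner (fun x => (σ x : ℂ)) (discChar (freqMod n ξ.1)) := by
  rw [SobolevSpace.coord_eq, odometerField, SobolevSpace.coeff_ofFun ha (memLp_interpolation _ _),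
    fourierCoeff_const_mul, fourierCoeff_interpolation]
  by_cases h : freqMod n ξ.1 = 0
  · rw [fieldCoeff_eq_zero h, sincProd_eq_zero ξ.2 h, Complex.ofReal_zero]
    ring
  · rw [discInner_odometer hd σ h, fieldCoeff, eigenRatio]
    push_cast
    ring

lemma inner_odometerField (hd : d ≠ 0) (ha : a ≤ s) (σ : DTorus d n → ℝ) (ξ : Freq d) :
    inner ℝ (hartleyBasis d s a ξ) (odometerField s a σ) =
      fieldCoeff s a n ξ * hartleyTransform (freqMod n ξ.1) σ := by
  rw [inner_hartleyBasis, coord_odometerField hd ha, Complex.re_ofReal_mul, Complex.im_ofReal_mul,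
    hartleyTransform_eq_re_add_im, mul_add]

lemma isLinearMap_odometerField (hd : d ≠ 0) (ha : a ≤ s) :
    IsLinearMap ℝ (odometerField s a : (DTorus d n → ℝ) → SobolevSpace d s a) where
  map_add σ τ := (hartleyBasis d s a).repr.injective <| lp.ext <| funext fun ξ => by
    simp only [map_add, lp.coeFn_add, Pi.add_apply, HilbertBasis.repr_apply_apply,
      inner_odometerField hd ha, mul_add]
  map_smul c σ := (hartleyBasis d s a).repr.injective <| lp.ext <| funext fun ξ => by
    simp only [map_smul, lp.coeFn_smul, Pi.smul_apply, HilbertBasis.repr_apply_apply,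
      inner_odometerField hd ha, smul_eq_mul, mul_left_comm]

/-- The odometer field as a continuous linear function of the initial field. -/
def odometerFieldCLM (hd : d ≠ 0) (ha : a ≤ s) : (DTorus d n → ℝ) →L[ℝ] SobolevSpace d s a :=
  ((isLinearMap_odometerField hd ha).mk' _).toContinuousLinearMap

variable {Ω : Type*} [MeasurableSpace Ω] {P : Measure Ω} {σ : Ω → DTorus d n → ℝ}
  {A : (DTorus d n → ℂ) → DTorus d n → ℂ}

lemma hasGaussianLaw_odometerField (hd : d ≠ 0) (ha : a ≤ s) (hσ : IsCenteredGaussian P σ A) :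
    HasGaussianLaw (fun ω => odometerField s a (σ ω)) P :=
  hσ.gaussian.map_fun (odometerFieldCLM hd ha)

lemma integral_inner_odometerField (hd : d ≠ 0) (ha : a ≤ s) (hσ : IsCenteredGaussian P σ A)
    (t : SobolevSpace d s a) :
    ∫ x, inner ℝ t x ∂(P.map fun ω => odometerField s a (σ ω)) = 0 := by
  rw [integral_map (hasGaussianLaw_odometerField hd ha hσ).aemeasurable (by fun_prop)]
  exact hσ.integral_clm ((innerSL ℝ t).comp (odometerFieldCLM hd ha))

/-- The covariance of the Hartley coordinates of the odometer field. -/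
def fieldCov (s a : ℝ) (n : ℕ) (ξ η : Freq d) : ℝ :=
  fieldCoeff s a n ξ * fieldCoeff s a n η *
    if freqMod n η.1 = freqMod n ξ.1 then eigenRatio n ξ.1 ^ (2 * s) else 0

lemma integral_inner_mul_inner_odometerField (hd : d ≠ 0) (ha : a ≤ s)
    (hσ : IsCenteredGaussian P σ
      (fun f x => ((scaling d n ^ (2 * s) : ℝ) : ℂ) * discFracLaplacian (2 * s) f x))
    (ξ η : Freq d) :
    ∫ x, inner ℝ (hartleyBasis d s a ξ) x * inner ℝ (hartleyBasis d s a η) x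
      ∂(P.map fun ω => odometerField s a (σ ω)) = fieldCov s a n ξ η := by
  rw [integral_map (hasGaussianLaw_odometerField hd ha hσ).aemeasurable (by fun_prop), fieldCov]
  simp only [inner_odometerField hd ha, mul_mul_mul_comm (fieldCoeff s a n ξ)]
  rw [integral_const_mul]
  by_cases h : freqMod n ξ.1 = 0
  · rw [fieldCoeff_eq_zero h, zero_mul, zero_mul, zero_mul]
  · rw [integral_hartleyTransform_mul hσ h, scaling_rpow_mul_eigenvalue_rpow hd h]

end OdometerField

section Asymptotics

variable {d n : ℕ} {s a : ℝ}

lemma eventually_freqMod_ne_zero {ζ : Fin d → ℤ} (hζ : ζ ≠ 0) :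
    ∀ᶠ n : ℕ in atTop, freqMod n ζ ≠ 0 := by
  obtain ⟨i, hi : ζ i ≠ 0⟩ := Function.ne_iff.1 hζ
  filter_upwards [eventually_gt_atTop (ζ i).natAbs] with n hn h
  have hdvd := (ZMod.intCast_zmod_eq_zero_iff_dvd (ζ i) n).1 (congrFun h i)
  exact hi (Int.eq_zero_of_abs_lt_dvd hdvd (by rw [Int.abs_eq_natAbs]; exact_mod_cast hn))

lemma eventually_freqMod_ne {ξ η : Fin d → ℤ} (h : ξ ≠ η) :
    ∀ᶠ n : ℕ in atTop, freqMod n ξ ≠ freqMod n η := by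
  filter_upwards [eventually_freqMod_ne_zero (sub_ne_zero.2 h)] with n hn heq
  refine hn (funext fun i => ?_)
  have hi : (ξ i : ZMod n) = η i := congrFun heq i
  change ((ξ i - η i : ℤ) : ZMod n) = 0
  rw [Int.cast_sub, hi, sub_self]

lemma rpow_le_rpow_add_rpow {x y z : ℝ} (hx : 0 < x) (hxy : x ≤ y) (hyz : y ≤ z) (p : ℝ) :
    y ^ p ≤ x ^ p + z ^ p := by
  have hy := hx.trans_le hxy
  rcases le_total 0 p with hp | hp
  · exact (Real.rpow_le_rpow hy.le hyz hp).trans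
      (le_add_of_nonneg_left (Real.rpow_nonneg hx.le p))
  · exact (Real.rpow_le_rpow_of_nonpos hx hxy hp).trans
      (le_add_of_nonneg_right (Real.rpow_nonneg (hy.le.trans hyz) p))

/-- The standard deviation of the Hartley coordinates of the limiting field. -/
def limitStd (s a : ℝ) (ξ : Freq d) : ℝ :=
  Real.sqrt (weight s a ξ) * freqNorm ξ ^ (-2 * (s + 1))

lemma limitStd_sq (ξ : Freq d) :
    limitStd s a ξ ^ 2 = weight s a ξ * (freqNorm ξ ^ (-2 : ℝ)) ^ (2 * (s + 1)) := by
  rw [limitStd, mul_pow, Real.sq_sqrt (weight_pos s a ξ).le, ← Real.rpow_mul_natCast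
    (freqNorm_pos ξ).le, ← Real.rpow_mul (freqNorm_pos ξ).le]
  congr 2
  push_cast
  ring

lemma summable_weight (h : 4 * a - 4 * s < -d) : Summable (weight (d := d) s a) := by
  simpa only [← weight_eq_rpow] using summable_freqNorm_rpow h

lemma summable_limitStd_sq (h : 4 * a - 8 * s - 4 < -d) :
    Summable fun ξ : Freq d => limitStd s a ξ ^ 2 := by
  refine (summable_freqNorm_rpow h).congr fun ξ => ?_
  rw [limitStd_sq, weight_eq_rpow, ← Real.rpow_mul (freqNorm_pos ξ).le,
    ← Real.rpow_add (freqNorm_pos ξ)]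
  ring_nf

variable [NeZero n]

lemma fieldCov_self (hd : d ≠ 0) {ξ : Freq d} (h : freqMod n ξ.1 ≠ 0) :
    fieldCov s a n ξ ξ =
      weight s a ξ * sincProd n ξ.1 ^ 2 * eigenRatio n ξ.1 ^ (2 * (s + 1)) := by
  have hpow : eigenRatio n ξ.1 ^ (2 * (s + 1)) =
      eigenRatio n ξ.1 ^ 2 * eigenRatio n ξ.1 ^ (2 * s) := by
    rw [← Real.rpow_natCast, ← Real.rpow_add (eigenRatio_pos hd h)]
    congr 1
    push_cast
    ring
  rw [fieldCov, if_pos rfl, hpow, fieldCoeff]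
  linear_combination (sincProd n ξ.1 ^ 2 * eigenRatio n ξ.1 ^ 2 * eigenRatio n ξ.1 ^ (2 * s)) *
    Real.mul_self_sqrt (weight_pos s a ξ).le

lemma fieldCov_self_le (hd : d ≠ 0) (ξ : Freq d) :
    fieldCov s a n ξ ξ ≤
      limitStd s a ξ ^ 2 + weight s a ξ * (Real.pi ^ 2 / 4) ^ (2 * (s + 1)) := by
  have hw := (weight_pos s a ξ).le
  by_cases h : freqMod n ξ.1 = 0
  · rw [fieldCov, fieldCoeff_eq_zero h, zero_mul, zero_mul]
    positivity
  have hsinc : sincProd n ξ.1 ^ 2 ≤ 1 := (sq_le_one_iff_abs_le_one _).2 (abs_sincProd_le_one n ξ.1)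
  have hratio := rpow_le_rpow_add_rpow (Real.rpow_pos_of_pos (freqNorm_pos ξ) (-2))
    (freqNorm_rpow_le_eigenRatio hd h) (eigenRatio_le hd h) (2 * (s + 1))
  calc fieldCov s a n ξ ξ
      = weight s a ξ * sincProd n ξ.1 ^ 2 * eigenRatio n ξ.1 ^ (2 * (s + 1)) := fieldCov_self hd h
    _ ≤ weight s a ξ * 1 *
          ((freqNorm ξ ^ (-2 : ℝ)) ^ (2 * (s + 1)) + (Real.pi ^ 2 / 4) ^ (2 * (s + 1))) := by
        have := (eigenRatio_pos hd h).le
        gcongr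
    _ = _ := by rw [mul_one, mul_add, limitStd_sq]

lemma tendsto_fieldCov_self (hd : d ≠ 0) (ξ : Freq d) :
    Tendsto (fun n : ℕ => fieldCov s a n ξ ξ) atTop (𝓝 (limitStd s a ξ ^ 2)) := by
  have hlim : Tendsto (fun n : ℕ =>
      weight s a ξ * sincProd n ξ.1 ^ 2 * eigenRatio n ξ.1 ^ (2 * (s + 1))) atTop
      (𝓝 (weight s a ξ * 1 ^ 2 * (freqNorm ξ ^ (-2 : ℝ)) ^ (2 * (s + 1)))) :=
    (((tendsto_sincProd ξ.1).pow 2).const_mul _).mul ((tendsto_eigenRatio hd ξ).rpow_const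
      (Or.inl (Real.rpow_pos_of_pos (freqNorm_pos ξ) _).ne'))
  rw [one_pow, mul_one, ← limitStd_sq] at hlim
  refine hlim.congr' ?_
  filter_upwards [eventually_gt_atTop 0, eventually_freqMod_ne_zero ξ.2] with n hn h
  have : NeZero n := ⟨hn.ne'⟩
  exact (fieldCov_self hd h).symm

lemma tendsto_fieldCov (hd : d ≠ 0) (ξ η : Freq d) :
    Tendsto (fun n : ℕ => fieldCov s a n ξ η) atTop
      (𝓝 (if ξ = η then limitStd s a ξ ^ 2 else 0)) := by
  split_ifs with h
  · subst h
    exact tendsto_fieldCov_self hd ξ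
  · refine tendsto_const_nhds.congr' ?_
    filter_upwards [eventually_freqMod_ne (Subtype.coe_ne_coe.2 (Ne.symm h))] with n hn
    rw [fieldCov, if_neg hn, mul_zero]

end Asymptotics

section Limit

variable {d : ℕ} {s a : ℝ}

lemma tsum_sq_limitStd_mul_inner_testVector {f : Torus d → ℝ} (hf : IsSmooth f) :
    ∑' ξ, (limitStd s a ξ * inner ℝ (testVector s a hf) (hartleyBasis d s a ξ)) ^ 2 =
      ∫ x, ‖fracLaplacian (-(s + 1)) f x‖ ^ 2 ∂torusMeasure d := by
  let v (ξ : Freq d) : ℂ := (freqNorm ξ ^ (-2 * (s + 1)) : ℝ) * fourierCoeff f ξ.1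
  have hv_opp (ξ : Freq d) : v ξ.opp = conj (v ξ) := by
    simp only [v]
    rw [freqNorm_opp, map_mul, Complex.conj_ofReal, ← fourierCoeff_neg]
    rfl
  have hv_norm (ξ : Freq d) :
      ‖v ξ‖ ^ 2 = freqNorm ξ ^ (4 * -(s + 1)) * ‖fourierCoeff f ξ.1‖ ^ 2 := by
    rw [norm_mul, mul_pow, Complex.norm_real, Real.norm_eq_abs, sq_abs,
      ← Real.rpow_mul_natCast (freqNorm_pos ξ).le]
    congr 2
    push_cast
    ring
  have hcoord (ξ : Freq d) :
      limitStd s a ξ * inner ℝ (testVector s a hf) (hartleyBasis d s a ξ) =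
        (v ξ).re + (v ξ).im := by
    have hw := Real.sqrt_ne_zero'.2 (weight_pos s a ξ)
    rw [real_inner_comm, inner_hartleyBasis, coord_testVector, limitStd, Complex.re_ofReal_mul,
      Complex.im_ofReal_mul, Complex.re_ofReal_mul, Complex.im_ofReal_mul]
    field_simp
  simp only [hcoord]
  rw [hf.integral_norm_sq_fracLaplacian, tsum_sq_re_add_im hv_opp]
  · exact tsum_congr hv_norm
  · simpa only [hv_norm] using hf.summable_rpow_mul_norm_fourierCoeff_sq _

/-- The law of the limiting field `Ξ`. -/
def limitLaw (d : ℕ) (s a : ℝ) : Measure (SobolevSpace d s a) :=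
  gaussianSeriesLaw (hartleyBasis d s a) (limitStd s a)

section

variable (h : 4 * a - 8 * s - 4 < -d)

include h

lemma isProbabilityMeasure_limitLaw : IsProbabilityMeasure (limitLaw d s a) :=
  isProbabilityMeasure_gaussianSeriesLaw (hartleyBasis d s a).orthonormal (summable_limitStd_sq h)

lemma map_inner_limitLaw (t : SobolevSpace d s a) :
    (limitLaw d s a).map (fun x => inner ℝ t x) = gaussianReal 0
      (∑' ξ, (limitStd s a ξ * inner ℝ t (hartleyBasis d s a ξ)) ^ 2).toNNReal :=
  map_inner_gaussianSeriesLaw (hartleyBasis d s a).orthonormal (summable_limitStd_sq h) t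

lemma isGaussian_limitLaw : IsGaussian (limitLaw d s a) :=
  isGaussian_of_map_inner _ (map_inner_limitLaw h)

lemma isFractionalField_limitLaw : IsFractionalField (limitLaw d s a) := fun f hf _ => by
  rw [funext (pairing_eq_inner hf), map_inner_limitLaw h, tsum_sq_limitStd_mul_inner_testVector]

end

lemma IsFractionalField.charFun_eq {μ ν : Measure (SobolevSpace d s a)} (hμ : IsFractionalField μ)
    (hν : IsFractionalField ν) {f : Torus d → ℝ} (hf : IsSmooth f)
    (hf₀ : ∫ x, f x ∂torusMeasure d = 0) :
    charFun ν (testVector s a hf) = charFun μ (testVector s a hf) := by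
  have hmap (ρ : Measure (SobolevSpace d s a)) :
      charFun ρ (testVector s a hf) = charFun (ρ.map (SobolevSpace.pairing f)) 1 := by
    rw [funext (pairing_eq_inner hf), charFun_apply, charFun_apply,
      integral_map (by fun_prop) (by fun_prop)]
    simp [real_inner_comm]
  rw [hmap, hmap, hμ f hf hf₀, hν f hf hf₀]

lemma IsFractionalField.eq {μ ν : Measure (SobolevSpace d s a)} [IsProbabilityMeasure μ]
    [IsProbabilityMeasure ν] (hμ : IsFractionalField μ) (hν : IsFractionalField ν) : ν = μ := by
  have htrig (S : Finset (Freq d)) (t : Freq d → ℝ) :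
      charFun ν (∑ ξ ∈ S, t ξ • hartleyBasis d s a ξ) =
        charFun μ (∑ ξ ∈ S, t ξ • hartleyBasis d s a ξ) := by
    rw [← testVector_trigPoly]
    exact hμ.charFun_eq hν (isSmooth_trigPoly S t) (integral_trigPoly S t)
  refine Measure.ext_of_charFun (funext fun x => ?_)
  have hx := (hartleyBasis d s a).hasSum_repr x
  refine tendsto_nhds_unique ((continuous_charFun.tendsto x).comp hx) ?_
  exact ((continuous_charFun.tendsto x).comp hx).congr fun S => (htrig S _).symm

end Limit

section Convergence

variable {d : ℕ} {s a : ℝ} {Ω : ℕ+ → Type*} [∀ n, MeasurableSpace (Ω n)]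
  {P : ∀ n, Measure (Ω n)} [∀ n, IsProbabilityMeasure (P n)] {σ : ∀ n : ℕ+, Ω n → DTorus d n → ℝ}

lemma tendstoInDistribution_odometerField (hd : d ≠ 0) (ha : a ≤ s) (h₁ : 4 * a - 4 * s < -d)
    (h₂ : 4 * a - 8 * s - 4 < -d)
    (hσ : ∀ n : ℕ+, IsCenteredGaussian (P n) (σ n)
      (fun f x => ((scaling d n ^ (2 * s) : ℝ) : ℂ) * discFracLaplacian (2 * s) f x))
    [IsProbabilityMeasure (limitLaw d s a)] :
    TendstoInDistribution (fun (n : ℕ+) ω => odometerField s a (σ n ω)) atTop id P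
      (limitLaw d s a) := by
  have hlaw (n : ℕ+) := hasGaussianLaw_odometerField hd ha (hσ n)
  let ν (n : ℕ+) : ProbabilityMeasure (SobolevSpace d s a) :=
    ⟨(P n).map fun ω => odometerField s a (σ n ω),
      Measure.isProbabilityMeasure_map (hlaw n).aemeasurable⟩
  let μ : ProbabilityMeasure (SobolevSpace d s a) := ⟨limitLaw d s a, inferInstance⟩
  have hν (n : ℕ+) : IsGaussian (ν n : Measure (SobolevSpace d s a)) := (hlaw n).isGaussian_map
  have hμ : IsGaussian (μ : Measure (SobolevSpace d s a)) := isGaussian_limitLaw h₂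
  have hcov_ν (n : ℕ+) (ξ η : Freq d) :
      ∫ x, inner ℝ (hartleyBasis d s a ξ) x * inner ℝ (hartleyBasis d s a η) x
        ∂(ν n : Measure (SobolevSpace d s a)) = fieldCov s a n ξ η :=
    integral_inner_mul_inner_odometerField hd ha (hσ n) ξ η
  have hcov_μ (ξ η : Freq d) :
      ∫ x, inner ℝ (hartleyBasis d s a ξ) x * inner ℝ (hartleyBasis d s a η) x
        ∂(μ : Measure (SobolevSpace d s a)) = if ξ = η then limitStd s a ξ ^ 2 else 0 :=
    integral_inner_mul_inner_gaussianSeriesLaw (hartleyBasis d s a).orthonormal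
      (summable_limitStd_sq h₂) ξ η
  have hbound := (summable_limitStd_sq h₂).add
    ((summable_weight h₁).mul_right ((Real.pi ^ 2 / 4) ^ (2 * (s + 1))))
  have hlim : Tendsto ν atTop (𝓝 μ) := by
    refine tendsto_of_isGaussian (hartleyBasis d s a)
      (fun n => integral_inner_odometerField hd ha (hσ n))
      (fun t => integral_inner_of_map_inner (map_inner_limitLaw h₂ t)) hbound
      (fun n ξ => ?_) fun ξ η => ?_
    · simp only [pow_two (inner ℝ _ _), hcov_ν]
      exact fieldCov_self_le hd ξ
    · simp only [hcov_ν, hcov_μ]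
      exact (tendsto_fieldCov hd ξ η).comp tendsto_PNat_val_atTop_atTop
  refine ⟨fun n => (hlaw n).aemeasurable, aemeasurable_id, ?_⟩
  simp only [Measure.map_id]
  exact hlim

end Convergence

end

end Sandpile

theorem proposition4_general (d : ℕ) (hd : 1 ≤ d) (s ε : ℝ) (hε₁ : (d : ℝ) / 4 < s + ε)
    (hε₂ : (d : ℝ) / 4 < 2 * s + 1 + ε)
    {Ω : ℕ+ → Type*} [∀ n, MeasurableSpace (Ω n)]
    (P : ∀ n, Measure (Ω n)) [∀ n, IsProbabilityMeasure (P n)]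
    (σ : ∀ n : ℕ+, Ω n → Sandpile.DTorus d n → ℝ)
    (hσ : ∀ n : ℕ+, Sandpile.IsCenteredGaussian (P n) (σ n)
      (fun f x => ((Sandpile.scaling d n ^ (2 * s) : ℝ) : ℂ) *
        Sandpile.discFracLaplacian (2 * s) f x)) :
    (∀ (n : ℕ+) (ω : Ω n) (x : Sandpile.DTorus d n),
      Summable (Sandpile.emission (Sandpile.initialConfig (σ n ω)) x)) ∧
    ∃ (μ : Measure (Sandpile.SobolevSpace d s (-ε))) (_ : IsProbabilityMeasure μ),
      IsGaussian μ ∧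
      Sandpile.IsFractionalField μ ∧
      (∀ ν : Measure (Sandpile.SobolevSpace d s (-ε)), IsProbabilityMeasure ν →
        Sandpile.IsFractionalField ν → ν = μ) ∧
      TendstoInDistribution
        (fun (n : ℕ+) (ω : Ω n) =>
          (Sandpile.SobolevSpace.ofFun (fun x => Sandpile.scaling d n *
            Sandpile.interpolation
              (Sandpile.odometer (Sandpile.initialConfig (σ n ω))) x) :
            Sandpile.SobolevSpace d s (-ε)))
        atTop id P μ := by
  have hd₀ : d ≠ 0 := Nat.one_le_iff_ne_zero.1 hd
  have ha : -ε ≤ s := by linarith [(Nat.cast_nonneg d : (0 : ℝ) ≤ d)]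
  have h₁ : 4 * -ε - 4 * s < -d := by linarith
  have h₂ : 4 * -ε - 8 * s - 4 < -d := by linarith
  have hprob := Sandpile.isProbabilityMeasure_limitLaw h₂
  have hfield := Sandpile.isFractionalField_limitLaw h₂
  exact ⟨fun n ω x => Sandpile.summable_emission hd₀ (Sandpile.sum_initialConfig_sub_one _) x,
    Sandpile.limitLaw d s (-ε), hprob, Sandpile.isGaussian_limitLaw h₂, hfield,
    fun ν _ hν => hfield.eq hν, Sandpile.tendstoInDistribution_odometerField hd₀ ha h₁ h₂ hσ⟩

theorem proposition4 (d : ℕ) (hd : 1 ≤ d) (s : ℝ) (hs : 0 < s)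
    (ε : ℝ) (hε : max ((d : ℝ) / 2) (1 + (d : ℝ) / 4) < ε)
    {Ω : ℕ+ → Type*} [∀ n, MeasurableSpace (Ω n)]
    (P : ∀ n, Measure (Ω n)) [∀ n, IsProbabilityMeasure (P n)]
    (σ : ∀ n : ℕ+, Ω n → Sandpile.DTorus d n → ℝ)
    (hσ : ∀ n : ℕ+, Sandpile.IsCenteredGaussian (P n) (σ n)
      (fun f x => ((Sandpile.scaling d n ^ (2 * s) : ℝ) : ℂ) *
        Sandpile.discFracLaplacian (2 * s) f x)) :
    -- the odometers are finite
    (∀ (n : ℕ+) (ω : Ω n) (x : Sandpile.DTorus d n),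
      Summable (Sandpile.emission (Sandpile.initialConfig (σ n ω)) x)) ∧
    -- the limiting field exists, its law is unique, and the convergence in law holds
    ∃ (μ : Measure (Sandpile.SobolevSpace d s (-ε))) (_ : IsProbabilityMeasure μ),
      IsGaussian μ ∧
      Sandpile.IsFractionalField μ ∧
      (∀ ν : Measure (Sandpile.SobolevSpace d s (-ε)), IsProbabilityMeasure ν →
        Sandpile.IsFractionalField ν → ν = μ) ∧
      TendstoInDistribution
        (fun (n : ℕ+) (ω : Ω n) =>
          (Sandpile.SobolevSpace.ofFun (fun x => Sandpile.scaling d n *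
            Sandpile.interpolation
              (Sandpile.odometer (Sandpile.initialConfig (σ n ω))) x) :
            Sandpile.SobolevSpace d s (-ε)))
        atTop id P μ := by
  have h := (max_lt_iff.1 hε).2
  exact proposition4_general d hd s ε (by linarith) (by linarith) P σ hσ
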